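/- Let $K$ be a field that is complete for an ultrametric norm $|\cdot|$, with infinite residue field and non-discrete value group $|K^*|$ (for instance $K$ complete, algebraically closed and non-trivially normed). Let $\mathbb P^1(K)=K\sqcup\{\infty\}$. *Balls.* For $a\in K$ and $r>0$ put $D^-(a,r)=\{z\in K: |z-a|<r\}$ and $D(a,r)=\{z\in K:|z-a|\le r\}$. If $r\in|K^*|$, these are an open and a closed ball of $K$; if $r\notin|K^*|$, they coincide and form an irrational ball of $K$. An open (resp. closed, irrational) ball of $\mathbb P^1(K)$ is such a ball of $K$, or the complement in $\mathbb P^1(K)$ of a closed (resp. open, irrational) ball of $K$. An open affinoid is a finite (possibly empty) intersection of open balls of $\mathbb P^1(K)$. *Berkovich line and weak topology.* Give $\mathbb P^1(K)$ the uniform structure whose entourages are the sets containing $\bigcup_{Y\in C}Y\times Y$ for some finite covering $C$ of $\mathbb P^1(K)$ by open affinoids. Let $\mathsf P^1_K$ (the Berkovich projective line) be its separated completion, i.e. the uniform space of minimal Cauchy filters; its topology is called the weak topology. A point of $\mathbb P^1(K)$ is identified with its filter of neighbourhoods. For $Y\subset\mathbb P^1(K)$ let $\widehat Y=\{\mathcal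 F\in\mathsf P^1_K: Y\in\mathcal F\}$, and let $\overline Y$ be the closure of $Y$ in $\mathsf P^1_K$. The open balls of $\mathsf P^1_K$ are the sets $\widehat B$ with $B$ an open or irrational ball of $\mathbb P^1(K)$; its closed balls are the sets $\overline B$ with $B$ a closed or irrational ball of $\mathbb P^1(K)$. For $\mathcal F\in\mathsf P^1_K$ let $B_{\mathcal F}$ be the intersection of all balls of $K$ that belong to $\mathcal F$. The point of $\mathsf P^1_K$ determined by a ball $B$ of $\mathbb P^1(K)$ (and by the corresponding ball $\widehat B$ or $\overline B$ of $\mathsf P^1_K$) is the unique $\mathcal F$ for which $B_{\mathcal F}$ is the closed or irrational ball of $K$ that contains $E$ and has the same diameter as $E$, where $E$ is whichever of $B$ and $\mathbb P^1(K)\setminus B$ is contained in $K$. *Fine topology.* Let $\mathsf A_K^{\mathbb R}$ be the quotient of $K\times[0,\infty)$ by the relation $(x,r)\sim(x',r')\iff r=r'\ge|x-x'|$, with the distance $\delta([x,r],[x',r'])=\max\{r,r',|x-x'|\}-\tfrac12(r+r')$, and let $\mathsf A_K$ be its completion. The function $\operatorname{diam}[x,r]=r$ extends continuously to $\mathsf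 A_K$; put $\sup\{S,S'\}=\delta(S,S')+\tfrac12(\operatorname{diam}S+\operatorname{diam}S')$, $|S|=\sup\{S,[0,0]\}$ and $m(S)=\max\{1,|S|\}$. Give $\mathsf A_K\sqcup\{\infty\}$ the distance $$\Delta(S,S')=\frac{\sup\{S,S'\}}{m(S)\,m(S')}-\frac{\operatorname{diam}S}{2\,m(S)^2}-\frac{\operatorname{diam}S'}{2\,m(S')^2},\qquad \Delta(S,\infty)=\frac1{m(S)}-\frac{\operatorname{diam}S}{2\,m(S)^2}.$$ There is a unique map $\iota:\mathsf A_K\sqcup\{\infty\}\to\mathsf P^1_K$ that is continuous for $\Delta$ and the weak topology and satisfies $B_{\iota([x,r])}=D(x,r)$ for all $x\in K$, $r>0$; it is bijective. The fine topology of $\mathsf P^1_K$ is the topology of $(\mathsf A_K\sqcup\{\infty\},\Delta)$ transported by $\iota$. **Corollary.** Every (open or closed) ball of $\mathsf P^1_K$ is connected for the weak topology and for the fine topology. The boundary of a ball of $\mathsf P^1_K$, for the fine topology as well as for the weak topology, consists of exactly one point, namely the point of $\mathsf P^1_K$ determined by this ball. -/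

import Mathlib

open Filter Topology Set
open scoped NNReal

namespace BerkovichLine

/-! ## Balls of `K` and of the projective line -/

section Balls

variable (K : Type*) [NormedField K]

/-- The value group `|K^*|`, as a set of positive real numbers. -/
def valueGroup : Set ℝ := {r | ∃ z : K, z ≠ 0 ∧ ‖z‖ = r}

/-- The projective line of `K`, as the set `K ⊔ {∞}` (see `OnePoint.equivProjectivization` for the
bijection with the set of lines of `K²`).  The topology that Mathlib puts on `OnePoint K` plays no
role below. -/
abbrev P1 : Type _ := OnePoint K

variable {K}

/-- Open balls of `K`: `{|z - a| < r}` with `r ∈ |K^*|`. -/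
def IsOpenBallK (D : Set K) : Prop := ∃ a : K, ∃ r ∈ valueGroup K, D = {z | ‖z - a‖ < r}

/-- Closed balls of `K`: `{|z - a| ≤ r}` with `r ∈ |K^*|`. -/
def IsClosedBallK (D : Set K) : Prop := ∃ a : K, ∃ r ∈ valueGroup K, D = {z | ‖z - a‖ ≤ r}

/-- Irrational balls of `K`: `{|z - a| < r}` (which is also `{|z - a| ≤ r}`) with `r > 0` not in
`|K^*|`. -/
def IsIrrationalBallK (D : Set K) : Prop :=
  ∃ a : K, ∃ r : ℝ, 0 < r ∧ r ∉ valueGroup K ∧ D = {z | ‖z - a‖ < r}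

/-- Balls of `K`, of any nature. -/
def IsBallK (D : Set K) : Prop := IsOpenBallK D ∨ IsClosedBallK D ∨ IsIrrationalBallK D

/-- A subset of `K`, seen in the projective line. -/
def toP1 (D : Set K) : Set (P1 K) := (fun z : K => (z : OnePoint K)) '' D

/-- Open balls of the projective line: open balls of `K` and complements of closed balls of `K`. -/
def IsOpenBall (B : Set (P1 K)) : Prop :=
  ∃ D : Set K, (IsOpenBallK D ∧ B = toP1 D) ∨ (IsClosedBallK D ∧ B = (toP1 D)ᶜ)

/-- Closed balls of the projective line: closed balls of `K` and complements of open balls of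
`K`. -/
def IsClosedBall (B : Set (P1 K)) : Prop :=
  ∃ D : Set K, (IsClosedBallK D ∧ B = toP1 D) ∨ (IsOpenBallK D ∧ B = (toP1 D)ᶜ)

/-- Irrational balls of the projective line: irrational balls of `K` and their complements. -/
def IsIrrationalBall (B : Set (P1 K)) : Prop :=
  ∃ D : Set K, IsIrrationalBallK D ∧ (B = toP1 D ∨ B = (toP1 D)ᶜ)

/-- Open affinoids: finite (possibly empty) intersections of open balls. -/
def IsOpenAffinoid (Y : Set (P1 K)) : Prop :=
  ∃ S : Set (Set (P1 K)), S.Finite ∧ (∀ B ∈ S, IsOpenBall B) ∧ Y = ⋂₀ S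

/-- Finite coverings of the projective line by open affinoids. -/
def IsAffinoidCover (C : Set (Set (P1 K))) : Prop :=
  C.Finite ∧ (∀ Y ∈ C, IsOpenAffinoid Y) ∧ ⋃₀ C = univ

/-- `V(C)`, the union of the squares `Y × Y` over the members `Y` of `C`. -/
def coverEntourage (C : Set (Set (P1 K))) : Set (P1 K × P1 K) := ⋃ Y ∈ C, Y ×ˢ Y

theorem IsOpenAffinoid.inter {Y Z : Set (P1 K)} (hY : IsOpenAffinoid Y) (hZ : IsOpenAffinoid Z) :
    IsOpenAffinoid (Y ∩ Z) := by
  obtain ⟨S, hS, hSb, rfl⟩ := hY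
  obtain ⟨T, hT, hTb, rfl⟩ := hZ
  refine ⟨S ∪ T, hS.union hT, ?_, (sInter_union S T).symm⟩
  rintro B (hB | hB)
  exacts [hSb B hB, hTb B hB]

theorem isOpenAffinoid_univ : IsOpenAffinoid (univ : Set (P1 K)) :=
  ⟨∅, finite_empty, by simp, by simp⟩

theorem IsAffinoidCover.inter {C C' : Set (Set (P1 K))} (h : IsAffinoidCover C)
    (h' : IsAffinoidCover C') : IsAffinoidCover (image2 (· ∩ ·) C C') := by
  refine ⟨h.1.image2 _ h'.1, ?_, ?_⟩
  · rintro _ ⟨Y, hY, Z, hZ, rfl⟩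
    exact (h.2.1 Y hY).inter (h'.2.1 Z hZ)
  · refine eq_univ_of_forall fun x => ?_
    obtain ⟨Y, hY, hxY⟩ : x ∈ ⋃₀ C := h.2.2 ▸ mem_univ x
    obtain ⟨Z, hZ, hxZ⟩ : x ∈ ⋃₀ C' := h'.2.2 ▸ mem_univ x
    exact ⟨Y ∩ Z, ⟨Y, hY, Z, hZ, rfl⟩, hxY, hxZ⟩

theorem coverEntourage_inter (C C' : Set (Set (P1 K))) :
    coverEntourage (image2 (· ∩ ·) C C') ⊆ coverEntourage C ∩ coverEntourage C' := by
  intro p hp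
  simp only [coverEntourage, mem_iUnion] at hp
  obtain ⟨_, ⟨Y, hY, Z, hZ, rfl⟩, h1, h2⟩ := hp
  simp only [coverEntourage, mem_inter_iff, mem_iUnion]
  exact ⟨⟨Y, hY, h1.1, h2.1⟩, ⟨Z, hZ, h1.2, h2.2⟩⟩

variable (K)

/-- The filter of entourages of the uniform structure on the projective line: the sets that
contain `V(C)` for some finite covering `C` by open affinoids. -/
def entourages : Filter (P1 K × P1 K) where
  sets := {V | ∃ C, IsAffinoidCover C ∧ coverEntourage C ⊆ V}
  univ_sets := ⟨{univ}, ⟨finite_singleton _, by simp [isOpenAffinoid_univ], by simp⟩,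
    subset_univ _⟩
  sets_of_superset := fun ⟨C, hC, h⟩ hVW => ⟨C, hC, h.trans hVW⟩
  inter_sets := fun ⟨C, hC, h⟩ ⟨C', hC', h'⟩ =>
    ⟨_, hC.inter hC', (coverEntourage_inter C C').trans (inter_subset_inter h h')⟩

end Balls

/-! ## The Berkovich projective line with its weak topology -/

section Berkovich

variable (K : Type*) [NormedField K]

variable {K} in
/-- Cauchy filters for the uniform structure `entourages K`. -/
def IsCauchyFilter (F : Filter (P1 K)) : Prop :=
  F.NeBot ∧ ∀ V ∈ entourages K, ∃ A ∈ F, A ×ˢ A ⊆ V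

/-- The Berkovich projective line, i.e. the separated completion of the projective line: the set
of minimal Cauchy filters.  In Mathlib `F ≤ G` means that `G` is coarser than `F`, i.e. every
member of `G` is a member of `F`. -/
def Ber : Type _ :=
  {F : Filter (P1 K) // IsCauchyFilter F ∧ ∀ G, IsCauchyFilter G → F ≤ G → G = F}

variable {K}

/-- The set of pairs of minimal Cauchy filters having a common `V`-small member. -/
def hatEntourage (V : Set (P1 K × P1 K)) : Set (Ber K × Ber K) :=
  {p | ∃ A : Set (P1 K), A ∈ p.1.1 ∧ A ∈ p.2.1 ∧ A ×ˢ A ⊆ V}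

theorem hatEntourage_mono {V W : Set (P1 K × P1 K)} (h : V ⊆ W) :
    hatEntourage V ⊆ hatEntourage W :=
  fun _ ⟨A, h1, h2, h3⟩ => ⟨A, h1, h2, h3.trans h⟩

variable (K) in
/-- The weak topology: the topology of the uniform structure on `Ber K` generated by the sets
`hatEntourage V`. -/
@[reducible] def weakTopology : TopologicalSpace (Ber K) where
  IsOpen U := ∀ F ∈ U, ∃ V ∈ entourages K, ∀ G, (F, G) ∈ hatEntourage V → G ∈ U
  isOpen_univ := fun _ _ => ⟨univ, univ_mem, fun _ _ => mem_univ _⟩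
  isOpen_inter := fun _ _ hU hU' F hF => by
    obtain ⟨V, hV, h⟩ := hU F hF.1
    obtain ⟨V', hV', h'⟩ := hU' F hF.2
    exact ⟨V ∩ V', inter_mem hV hV', fun G hG =>
      ⟨h G (hatEntourage_mono inter_subset_left hG),
        h' G (hatEntourage_mono inter_subset_right hG)⟩⟩
  isOpen_sUnion := fun S hS F ⟨U, hU, hF⟩ => by
    obtain ⟨V, hV, h⟩ := hS U hU F hF
    exact ⟨V, hV, fun G hG => ⟨U, hU, h G hG⟩⟩

/-- The point of `Ber K` that is identified with the point `x` of the projective line is the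
filter of neighbourhoods `V(x)` of `x` for the uniform structure. -/
def IsClassicalPoint (F : Ber K) (x : P1 K) : Prop :=
  ∀ A : Set (P1 K), A ∈ F.1 ↔ ∃ V ∈ entourages K, {y | (x, y) ∈ V} ⊆ A

/-- A subset of the projective line, seen as a subset of `Ber K`. -/
def classicalImage (Y : Set (P1 K)) : Set (Ber K) := {F | ∃ x ∈ Y, IsClassicalPoint F x}

/-- The set `Ŷ` of the points of `Ber K`, as filters, that contain `Y`. -/
def hat (Y : Set (P1 K)) : Set (Ber K) := {F | Y ∈ F.1}

/-- The closure of `Y` in `Ber K` for the weak topology. -/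
def bar (Y : Set (P1 K)) : Set (Ber K) := @closure _ (weakTopology K) (classicalImage Y)

/-- `𝔅` is the open ball, or the closed ball, of `Ber K` that is given by the ball `B` of the
projective line.  An irrational ball `B` gives both an open and a closed ball. -/
def IsBerBall (B : Set (P1 K)) (𝔅 : Set (Ber K)) : Prop :=
  ((IsOpenBall B ∨ IsIrrationalBall B) ∧ 𝔅 = hat B) ∨
    ((IsClosedBall B ∨ IsIrrationalBall B) ∧ 𝔅 = bar B)

/-- `B_F`, the intersection of all the balls of `K` that belong to the filter `F`. -/
def core (F : Ber K) : Set (P1 K) := ⋂₀ {A | A ∈ F.1 ∧ ∃ D : Set K, IsBallK D ∧ A = toP1 D}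

/-- `F` is the point of `Ber K` determined by the ball `B` of the projective line: if `E` is the
one of `B` and its complement that is contained in `K`, then `B_F` is the closed or irrational
ball of `K` that contains `E` and has the same diameter as `E`. -/
def IsPointOfBall (F : Ber K) (B : Set (P1 K)) : Prop :=
  ∃ D E : Set K, (B = toP1 E ∨ B = (toP1 E)ᶜ) ∧ (IsClosedBallK D ∨ IsIrrationalBallK D) ∧
    E ⊆ D ∧ Metric.diam D = Metric.diam E ∧ core F = toP1 D

end Berkovich

/-! ## The tree of `K` -/

section Tree

/-- Pairs `(x, r)` with `x ∈ K` and `r ∈ [0, +∞)`. -/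
structure PreArb (K : Type*) where
  center : K
  radius : ℝ≥0

variable (K : Type*) [NormedField K] [IsUltrametricDist K]

variable {K} in
theorem delta_aux {x y z : K} {r s t : ℝ} :
    max (max r t) (dist x z) + s ≤ max (max r s) (dist x y) + max (max s t) (dist y z) := by
  have h := dist_triangle_max x y z
  have a1 := le_max_left r s
  have a2 := le_max_right r s
  have a3 := le_max_left (max r s) (dist x y)
  have a4 := le_max_right (max r s) (dist x y)
  have b1 := le_max_left s t
  have b2 := le_max_right s t
  have b3 := le_max_left (max s t) (dist y z)
  have b4 := le_max_right (max s t) (dist y z)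
  rcases le_max_iff.1 h with h | h
  · rw [← le_sub_iff_add_le]
    refine max_le (max_le ?_ ?_) ?_ <;> linarith
  · rw [← le_sub_iff_add_le]
    refine max_le (max_le ?_ ?_) ?_ <;> linarith

/-- The function `δ((x, r), (x', r')) = max {r, r', |x - x'|} - (r + r') / 2`. -/
noncomputable instance : PseudoMetricSpace (PreArb K) where
  dist p q := max (max (p.radius : ℝ) q.radius) (dist p.center q.center) -
    (p.radius + q.radius) / 2
  dist_self p := by simp
  dist_comm p q := by rw [max_comm (p.radius : ℝ), dist_comm, add_comm]
  dist_triangle p q s := by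
    have := delta_aux (x := p.center) (y := q.center) (z := s.center) (r := p.radius)
      (s := q.radius) (t := s.radius)
    linarith

variable {K} in
theorem PreArb.dist_def (p q : PreArb K) :
    dist p q = max (max (p.radius : ℝ) q.radius) (dist p.center q.center) -
      (p.radius + q.radius) / 2 := rfl

/-- The space of balls: the quotient of `K × [0, +∞)` by the relation
`(x, r) ∼ (x', r') ↔ r = r' ∧ |x - x'| ≤ r`, which is the relation `δ = 0` (see
`ArbR.mk_eq_mk_iff`), with the distance `δ`. -/
abbrev ArbR : Type _ := SeparationQuotient (PreArb K)

variable {K} in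
/-- The point `[x, r]` of the space of balls. -/
noncomputable def ArbR.mk (x : K) (r : ℝ≥0) : ArbR K := SeparationQuotient.mk ⟨x, r⟩

variable {K} in
theorem ArbR.mk_eq_mk_iff {x y : K} {r s : ℝ≥0} :
    ArbR.mk x r = ArbR.mk y s ↔ r = s ∧ dist x y ≤ r := by
  rw [ArbR.mk, ArbR.mk, SeparationQuotient.mk_eq_mk, Metric.inseparable_iff, PreArb.dist_def]
  dsimp only
  constructor
  · intro h
    have a1 := le_max_left (r : ℝ) s
    have a2 := le_max_right (r : ℝ) s
    have a3 := le_max_left (max (r : ℝ) s) (dist x y)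
    have a4 := le_max_right (max (r : ℝ) s) (dist x y)
    have : (r : ℝ) = s := by linarith
    exact ⟨NNReal.coe_injective this, by linarith⟩
  · rintro ⟨rfl, h⟩
    simp [h]

/-- The tree of `K`: the completion of the space of balls for `δ`. -/
abbrev Arb : Type _ := UniformSpace.Completion (ArbR K)

variable {K}

/-- The point `[x, r]` of the tree of `K`. -/
noncomputable def pt (x : K) (r : ℝ≥0) : Arb K := (ArbR.mk x r : UniformSpace.Completion (ArbR K))

theorem dist_pt (x y : K) (r s : ℝ≥0) :
    dist (pt x r) (pt y s) = max (max (r : ℝ) s) (dist x y) - (r + s) / 2 :=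
  UniformSpace.Completion.dist_eq _ _

theorem PreArb.lipschitz_radius : LipschitzWith 2 (fun p : PreArb K => (p.radius : ℝ)) := by
  refine LipschitzWith.of_dist_le_mul fun p q => ?_
  rw [Real.dist_eq, PreArb.dist_def, NNReal.coe_ofNat]
  have a1 := le_max_left (p.radius : ℝ) q.radius
  have a2 := le_max_right (p.radius : ℝ) q.radius
  have a3 := le_max_left (max (p.radius : ℝ) q.radius) (dist p.center q.center)
  rw [abs_le]
  constructor <;> linarith

/-- The function `diam` on the space of balls, `diam [x, r] = r`. -/
noncomputable def ArbR.diam : ArbR K → ℝ :=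
  SeparationQuotient.lift (fun p : PreArb K => (p.radius : ℝ))
    fun _ _ h => (h.map PreArb.lipschitz_radius.continuous).eq

/-- The function `diam` on the tree, extended from the space of balls by continuity. -/
noncomputable def diam : Arb K → ℝ := UniformSpace.Completion.extension ArbR.diam

theorem ArbR.uniformContinuous_diam : UniformContinuous (ArbR.diam (K := K)) := by
  rw [ArbR.diam, SeparationQuotient.uniformContinuous_lift]
  exact PreArb.lipschitz_radius.uniformContinuous

theorem continuous_diam : Continuous (diam (K := K)) := UniformSpace.Completion.continuous_extension

theorem diam_pt (x : K) (r : ℝ≥0) : diam (pt x r) = r :=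
  UniformSpace.Completion.extension_coe ArbR.uniformContinuous_diam _

/-- The function `sup {S, S'}`, which is determined by
`δ(S, S') = sup {S, S'} - (diam S + diam S') / 2`. -/
noncomputable def supr (S T : Arb K) : ℝ := dist S T + (diam S + diam T) / 2

theorem supr_pt (x y : K) (r s : ℝ≥0) :
    supr (pt x r) (pt y s) = max (max (r : ℝ) s) (dist x y) := by
  rw [supr, dist_pt, diam_pt, diam_pt]; ring

/-- The function `|S| = sup {S, 0}`, which extends `|[x, r]| = max {|x|, r}` (see `abv_pt`). -/
noncomputable def abv (S : Arb K) : ℝ := supr S (pt 0 0)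

theorem abv_pt (x : K) (r : ℝ≥0) : abv (pt x r) = max ‖x‖ r := by
  rw [abv, supr_pt, dist_zero_right, NNReal.coe_zero, max_eq_left r.coe_nonneg, max_comm]

theorem denseRange_pt : DenseRange (fun p : PreArb K => pt p.center p.radius) :=
  UniformSpace.Completion.denseRange_coe.comp
    SeparationQuotient.surjective_mk.denseRange (UniformSpace.Completion.continuous_coe _)

theorem continuous_supr : Continuous (fun p : Arb K × Arb K => supr p.1 p.2) :=
  continuous_dist.add
    (((continuous_diam.comp continuous_fst).add (continuous_diam.comp continuous_snd)).div_const 2)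

theorem diam_nonneg (S : Arb K) : 0 ≤ diam S :=
  isClosed_property denseRange_pt (isClosed_le continuous_const continuous_diam)
    (fun p => by rw [diam_pt]; exact p.radius.coe_nonneg) S

theorem supr_self (S : Arb K) : supr S S = diam S := by rw [supr, dist_self]; ring

theorem supr_comm (S T : Arb K) : supr S T = supr T S := by
  rw [supr, supr, dist_comm, add_comm (diam S)]

theorem supr_le_max (S T U : Arb K) : supr S U ≤ max (supr S T) (supr T U) := by
  have hc : ∀ {f g : Arb K × Arb K × Arb K → Arb K}, Continuous f → Continuous g →
      Continuous fun p => supr (f p) (g p) := fun hf hg => continuous_supr.comp (hf.prodMk hg)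
  refine isClosed_property3 denseRange_pt (p := fun S T U => supr S U ≤ max (supr S T) (supr T U))
    (isClosed_le (hc (by fun_prop) (by fun_prop))
      ((hc (by fun_prop) (by fun_prop)).max (hc (by fun_prop) (by fun_prop)))) (fun p q s => ?_)
    S T U
  simp only [supr_pt]
  have h := dist_triangle_max p.center q.center s.center
  grind

theorem diam_le_supr (S T : Arb K) : diam S ≤ supr S T := by
  have := supr_le_max S T S
  rwa [supr_self, supr_comm T S, max_self] at this

theorem diam_le_abv (S : Arb K) : diam S ≤ abv S := diam_le_supr _ _

theorem abv_nonneg (S : Arb K) : 0 ≤ abv S := (diam_nonneg S).trans (diam_le_abv S)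

theorem abv_le_max (S T : Arb K) : abv S ≤ max (supr S T) (abv T) := supr_le_max _ _ _

theorem supr_le_max_abv (S T : Arb K) : supr S T ≤ max (abv S) (abv T) := by
  have := supr_le_max S (pt 0 0) T
  rwa [supr_comm (pt 0 0) T] at this

end Tree

/-! ## The projective tree of `K` with the chordal distance -/

section ProjectiveTree

/-- The projective tree of `K`: the disjoint union of the tree of `K` and of a point `∞`. -/
inductive ArbP (K : Type*) [NormedField K] [IsUltrametricDist K]
  | of (S : Arb K) : ArbP K
  | infty : ArbP K

variable {K : Type*} [NormedField K] [IsUltrametricDist K]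

/-- The chordal distance on the projective tree.  Its values at the pairs that contain `∞` are the
limits for `|S'| → ∞` of the values on the tree; its restriction to `K ⊔ {∞}` is the usual chordal
distance `|x - y| / (max {1, |x|} max {1, |y|})`, `1 / max {1, |x|}`. -/
noncomputable def chordal : ArbP K → ArbP K → ℝ
  | .of S, .of T => supr S T / (max 1 (abv S) * max 1 (abv T)) -
      diam S / max 1 (abv S) ^ 2 / 2 - diam T / max 1 (abv T) ^ 2 / 2
  | .of S, .infty => 1 / max 1 (abv S) - diam S / max 1 (abv S) ^ 2 / 2
  | .infty, .of T => 1 / max 1 (abv T) - diam T / max 1 (abv T) ^ 2 / 2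
  | .infty, .infty => 0

/-- Auxiliary: the function `s` for which `chordal P Q = s P Q - s P P / 2 - s Q Q / 2`. -/
noncomputable def chordalSup : ArbP K → ArbP K → ℝ
  | .of S, .of T => supr S T / (max 1 (abv S) * max 1 (abv T))
  | .of S, .infty => 1 / max 1 (abv S)
  | .infty, .of T => 1 / max 1 (abv T)
  | .infty, .infty => 0

theorem chordal_eq (P Q : ArbP K) :
    chordal P Q = chordalSup P Q - chordalSup P P / 2 - chordalSup Q Q / 2 := by
  rcases P with S | _ <;> rcases Q with T | _ <;>
    simp [chordal, chordalSup, supr_self, sq]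

theorem chordalSup_comm (P Q : ArbP K) : chordalSup P Q = chordalSup Q P := by
  rcases P with S | _ <;> rcases Q with T | _ <;> simp only [chordalSup]
  rw [supr_comm, mul_comm]

theorem chordal_aux {a b c x y z : ℝ} (ha : 0 < a) (hb : 0 < b) (hc : 0 < c) (hx : 0 ≤ x)
    (hy : 0 ≤ y) (h1 : z ≤ max x y) (h2 : z ≤ max a c) (h3 : b ≤ max a x)
    (h4 : b ≤ max c y) : z / (a * c) ≤ max (x / (a * b)) (y / (b * c)) := by
  have main : z * b ≤ x * c ∨ z * b ≤ y * a := by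
    have p1 : ∀ {u v : ℝ}, z ≤ u → b ≤ v → 0 ≤ u → z * b ≤ u * v := fun h h' hu =>
      mul_le_mul h h' hb.le hu
    have p2 : ∀ {u v : ℝ}, z ≤ v → b ≤ u → 0 ≤ v → z * b ≤ u * v := fun h h' hu => by
      have := p1 h h' hu
      linarith
    rcases le_max_iff.1 h1 with hzx | hzy
    · by_cases hbc : b ≤ c
      · exact .inl (p1 hzx hbc hx)
      · have hby : b ≤ y := (le_max_iff.1 h4).resolve_left hbc
        rcases le_max_iff.1 h2 with hza | hzc
        · exact .inr (p2 hza hby ha.le)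
        · rcases le_max_iff.1 h3 with hba | hbx
          · exact .inr (p2 (hzc.trans ((le_of_not_ge hbc).trans hba)) hby ha.le)
          · exact .inl (p2 hzc hbx hc.le)
    · by_cases hba : b ≤ a
      · exact .inr (p1 hzy hba hy)
      · have hbx : b ≤ x := (le_max_iff.1 h3).resolve_left hba
        rcases le_max_iff.1 h2 with hza | hzc
        · rcases le_max_iff.1 h4 with hbc | hby
          · exact .inl (p2 (hza.trans ((le_of_not_ge hba).trans hbc)) hbx hc.le)
          · exact .inr (p2 hza hby ha.le)
        · exact .inl (p2 hzc hbx hc.le)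
  rcases main with h | h
  · refine le_max_of_le_left ?_
    rw [div_le_div_iff₀ (by positivity) (by positivity)]
    linarith [mul_le_mul_of_nonneg_left h ha.le]
  · refine le_max_of_le_right ?_
    rw [div_le_div_iff₀ (by positivity) (by positivity)]
    linarith [mul_le_mul_of_nonneg_left h hc.le]

theorem chordalSup_le_max (P Q R : ArbP K) :
    chordalSup P R ≤ max (chordalSup P Q) (chordalSup Q R) := by
  have hM : ∀ S : Arb K, 0 < max 1 (abv S) := fun S => lt_max_of_lt_left one_pos
  have hs : ∀ S T : Arb K, 0 ≤ supr S T := fun S T => (diam_nonneg S).trans (diam_le_supr S T)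
  have hm : ∀ S T : Arb K, max 1 (abv S) ≤ max (max 1 (abv T)) (supr S T) := by
    intro S T
    have := abv_le_max S T
    grind
  have hsm : ∀ S T : Arb K, supr S T ≤ max (max 1 (abv S)) (max 1 (abv T)) := by
    intro S T
    have := supr_le_max_abv S T
    grind
  have hi : ∀ S : Arb K, 0 ≤ 1 / max 1 (abv S) := fun S => (one_div_pos.2 (hM S)).le
  have two : ∀ S T : Arb K, 1 / max 1 (abv S) ≤
      max (supr S T / (max 1 (abv S) * max 1 (abv T))) (1 / max 1 (abv T)) := by
    intro S T
    rcases le_max_iff.1 (hm T S) with h | h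
    · exact le_max_of_le_right (one_div_le_one_div_of_le (hM T) h)
    · refine le_max_of_le_left ?_
      rw [div_le_div_iff₀ (hM S) (mul_pos (hM S) (hM T)), supr_comm]
      linarith [mul_le_mul_of_nonneg_left h (hM S).le]
  rcases P with S | _ <;> rcases Q with T | _ <;> rcases R with U | _ <;> simp only [chordalSup]
  · refine chordal_aux (hM S) (hM T) (hM U) (hs _ _) (hs _ _) (supr_le_max _ _ _)
      (hsm _ _) ?_ (hm _ _)
    rw [supr_comm]
    exact hm _ _
  · exact two S T
  · rcases le_max_iff.1 (hsm S U) with h | h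
    · refine le_max_of_le_right ?_
      rw [div_le_div_iff₀ (mul_pos (hM S) (hM U)) (hM U)]
      linarith [mul_le_mul_of_nonneg_right h (hM U).le]
    · refine le_max_of_le_left ?_
      rw [div_le_div_iff₀ (mul_pos (hM S) (hM U)) (hM S)]
      linarith [mul_le_mul_of_nonneg_right h (hM S).le]
  · exact le_max_left _ _
  · have := two U T
    rwa [max_comm (supr U T / _), supr_comm U, mul_comm (max 1 (abv U))] at this
  · exact le_max_of_le_left (hi T)
  · exact le_max_right _ _
  · exact le_max_left _ _

theorem chordalSup_self_le (P Q : ArbP K) : chordalSup P P ≤ chordalSup P Q := by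
  have := chordalSup_le_max P Q P
  rwa [chordalSup_comm Q P, max_self] at this

theorem eq_of_chordal_eq_zero {P Q : ArbP K} (h : chordal P Q = 0) : P = Q := by
  have hM : ∀ S : Arb K, 0 < max 1 (abv S) := fun S => lt_max_of_lt_left one_pos
  have hinf : ∀ S : Arb K, chordal (ArbP.of S) ArbP.infty ≠ 0 := by
    intro S hS
    simp only [chordal] at hS
    have h1 : diam S ≤ max 1 (abv S) := (diam_le_abv S).trans (le_max_right _ _)
    have h2 : diam S / max 1 (abv S) ^ 2 ≤ 1 / max 1 (abv S) := by
      rw [div_le_div_iff₀ (pow_pos (hM S) 2) (hM S)]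
      linarith [mul_le_mul_of_nonneg_right h1 (hM S).le]
    have := one_div_pos.2 (hM S)
    linarith
  rcases P with S | _ <;> rcases Q with T | _
  · have h1 := chordalSup_self_le (ArbP.of S) (ArbP.of T)
    have h2 := chordalSup_self_le (ArbP.of T) (ArbP.of S)
    rw [chordalSup_comm (ArbP.of T) (ArbP.of S)] at h2
    rw [chordal_eq] at h
    have e1 : chordalSup (ArbP.of S) (ArbP.of S) = chordalSup (ArbP.of S) (ArbP.of T) := by
      linarith
    have e2 : chordalSup (ArbP.of T) (ArbP.of T) = chordalSup (ArbP.of S) (ArbP.of T) := by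
      linarith
    simp only [chordalSup, supr_self] at e1 e2
    have hS := hM S
    have hT := hM T
    rw [div_eq_div_iff (by positivity) (by positivity)] at e1 e2
    have e1' : diam S * max 1 (abv T) = supr S T * max 1 (abv S) := by
      apply mul_left_cancel₀ hS.ne'; linarith
    have e2' : diam T * max 1 (abv S) = supr S T * max 1 (abv T) := by
      apply mul_left_cancel₀ hT.ne'; linarith
    have d1 := diam_le_supr S T
    have d2 := diam_le_supr T S
    rw [supr_comm] at d2
    have n1 := diam_nonneg S
    have n2 := diam_nonneg T
    have : dist S T ≤ 0 := by
      have hd : dist S T = supr S T - (diam S + diam T) / 2 := by rw [supr]; ring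
      rw [hd]
      rcases le_total (max 1 (abv S)) (max 1 (abv T)) with hle | hle
      · have : supr S T * max 1 (abv T) ≤ diam T * max 1 (abv T) := by
          rw [← e2']; exact mul_le_mul_of_nonneg_left hle n2
        have i2 := le_of_mul_le_mul_right this hT
        rcases eq_or_lt_of_le (n2.trans d2) with h0 | h0
        · linarith
        · have : max 1 (abv S) = max 1 (abv T) := by
            have : diam T = supr S T := le_antisymm d2 i2
            rw [this] at e2'
            exact mul_left_cancel₀ h0.ne' e2'
          rw [this] at e1'
          have := mul_right_cancel₀ hT.ne' e1'
          linarith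
      · have : supr S T * max 1 (abv S) ≤ diam S * max 1 (abv S) := by
          rw [← e1']; exact mul_le_mul_of_nonneg_left hle n1
        have i1 := le_of_mul_le_mul_right this hS
        rcases eq_or_lt_of_le (n1.trans d1) with h0 | h0
        · linarith
        · have : max 1 (abv T) = max 1 (abv S) := by
            have : diam S = supr S T := le_antisymm d1 i1
            rw [this] at e1'
            exact mul_left_cancel₀ h0.ne' e1'
          rw [this] at e2'
          have := mul_right_cancel₀ hS.ne' e2'
          linarith
    rw [dist_le_zero.1 this]
  · exact absurd h (hinf S)
  · exact absurd h (hinf T)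
  · rfl

noncomputable instance : MetricSpace (ArbP K) where
  dist := chordal
  dist_self P := by rw [chordal_eq]; ring
  dist_comm P Q := by rw [chordal_eq, chordal_eq, chordalSup_comm]; ring
  dist_triangle P Q R := by
    have h1 := chordalSup_self_le Q P
    have h2 := chordalSup_self_le Q R
    rw [chordalSup_comm Q P] at h1
    rw [chordal_eq, chordal_eq, chordal_eq]
    rcases le_max_iff.1 (chordalSup_le_max P Q R) with h | h <;> linarith
  eq_of_dist_eq_zero := eq_of_chordal_eq_zero

end ProjectiveTree

/-! ## The identification of the two spaces, and the fine topology -/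

section Fine

variable {K : Type*} [NormedField K] [IsUltrametricDist K]

/-- `ι` is the extension by continuity, for the chordal distance and the weak topology, of the map
that sends the point `[x, r]` with `r > 0`, i.e. the closed or irrational ball
`{|z - x| ≤ r}` of `K`, to the minimal Cauchy filter `F` for which `B_F` is this ball. -/
structure IsCanonicalMap (ι : ArbP K → Ber K) : Prop where
  continuous : @Continuous _ _ _ (weakTopology K) ι
  core_eq : ∀ (x : K) (r : ℝ≥0), 0 < r → core (ι (.of (pt x r))) = toP1 {z | ‖z - x‖ ≤ r}

/-- The topology of the projective tree, given by the chordal distance, transported to the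
Berkovich projective line by `ι`. -/
@[reducible] noncomputable def fineTopology (ι : ArbP K → Ber K) : TopologicalSpace (Ber K) :=
  TopologicalSpace.coinduced ι (inferInstance : TopologicalSpace (ArbP K))

end Fine

end BerkovichLine

open BerkovichLine

/-! For `a : K` the function `|P - a|` on the tree takes its values in `[0, ∞]`, and it restricts to
a bijection on the ray of the points `[a, s]` from `a` to `∞`. The balls of the Berkovich line with
center `a` are the preimages of the half-lines of `[0, ∞]` under this function. It is locally
constant off the ray, so that the boundary of a preimage is the image under the ray of the boundary
of the half-line, which is a single point. The preimage of an interval is connected, since the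
fibres of the function are connected and meet the ray, whose part over the interval is a path.

The comparison with `Ber K` identifies a point `P` with the filter generated by the traces on the
projective line of the open balls that contain `P`. Every finite collection of these balls is seen
by classical points: near a point that is on no boundary by density of the classical points, and at
a boundary point because the residue field is infinite. The weak topology is therefore that of the
functions `|P - a|`, for which the tree is compact. -/

namespace BerkovichLine

open scoped ENNReal

/-! ## The value group and the residue field -/

section ValueGroup

variable {K : Type*} [NormedField K]

theorem pos_of_mem_valueGroup {r : ℝ} (hr : r ∈ valueGroup K) : 0 < r := by
  obtain ⟨z, hz, rfl⟩ := hr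
  exact norm_pos_iff.2 hz

theorem div_mem_valueGroup {r s : ℝ} (hr : r ∈ valueGroup K) (hs : s ∈ valueGroup K) :
    r / s ∈ valueGroup K := by
  obtain ⟨y, hy, rfl⟩ := hr
  obtain ⟨z, hz, rfl⟩ := hs
  exact ⟨y / z, div_ne_zero hy hz, norm_div y z⟩

theorem zpow_mem_valueGroup {r : ℝ} (hr : r ∈ valueGroup K) (n : ℤ) : r ^ n ∈ valueGroup K := by
  obtain ⟨z, hz, rfl⟩ := hr
  exact ⟨z ^ n, zpow_ne_zero n hz, norm_zpow z n⟩

variable (K) in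
/-- The value group is dense in the half-line of positive real numbers. This is the form in which
the hypothesis that the value group is not discrete is used. -/
class DenseValues : Prop where
  exists_mem_valueGroup_between : ∀ {s t : ℝ}, 0 ≤ s → s < t → ∃ c ∈ valueGroup K, s < c ∧ c < t

theorem exists_mem_valueGroup_one_lt_lt (hval : ¬ DiscreteTopology (valueGroup K)) {ε : ℝ}
    (hε : 1 < ε) : ∃ c ∈ valueGroup K, 1 < c ∧ c < ε := by
  by_contra! hno
  have hgap : ∀ v ∈ valueGroup K, ∀ w ∈ valueGroup K, v < w → v * ε ≤ w := by
    intro v hv w hw hvw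
    have hv0 := pos_of_mem_valueGroup hv
    have := hno _ (div_mem_valueGroup hw hv) ((one_lt_div hv0).2 hvw)
    rwa [le_div_iff₀' hv0] at this
  refine hval (discreteTopology_subtype_iff'.2 fun v hv => ⟨Ioo (v / ε) (v * ε), isOpen_Ioo, ?_⟩)
  have hv0 := pos_of_mem_valueGroup hv
  refine Subset.antisymm (fun w ⟨⟨hvw, hwv⟩, hw⟩ => ?_) (singleton_subset_iff.2
    ⟨⟨div_lt_self hv0 hε, lt_mul_of_one_lt_right hv0 hε⟩, hv⟩)
  rw [div_lt_iff₀ (one_pos.trans hε)] at hvw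
  exact le_antisymm (not_lt.1 fun h => (hgap v hv w hw h).not_gt hwv)
    (not_lt.1 fun h => (hgap w hw v hv h).not_gt hvw)

theorem DenseValues.of_not_discreteTopology (hval : ¬ DiscreteTopology (valueGroup K)) :
    DenseValues K where
  exists_mem_valueGroup_between {s t} hs hst := by
    obtain ⟨u, hsu, hut⟩ := exists_between hst
    have hu : 0 < u := hs.trans_lt hsu
    obtain ⟨c, hc, h1c, hct⟩ := exists_mem_valueGroup_one_lt_lt hval ((one_lt_div hu).2 hut)
    obtain ⟨n, hnu, hun⟩ := exists_mem_Ico_zpow hu h1c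
    refine ⟨c ^ (n + 1), zpow_mem_valueGroup hc _, hsu.trans hun, ?_⟩
    calc c ^ (n + 1) = c ^ n * c := zpow_add_one₀ (one_pos.trans h1c).ne' n
      _ ≤ u * c := by gcongr
      _ < t := by rwa [lt_div_iff₀' hu] at hct

theorem exists_mem_valueGroup_ofReal_between [DenseValues K] {s t : ℝ≥0∞} (h : s < t) :
    ∃ r ∈ valueGroup K, s < ENNReal.ofReal r ∧ ENNReal.ofReal r < t := by
  obtain ⟨u, hsu, hut⟩ := exists_between h
  lift u to ℝ≥0 using hut.ne_top
  lift s to ℝ≥0 using hsu.ne_top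
  obtain ⟨c, hc, hsc, hcu⟩ := DenseValues.exists_mem_valueGroup_between (K := K) s.coe_nonneg
    (NNReal.coe_lt_coe.2 (ENNReal.coe_lt_coe.1 hsu))
  lift c to ℝ≥0 using (pos_of_mem_valueGroup hc).le
  rw [NNReal.coe_lt_coe] at hsc hcu
  refine ⟨c, hc, ?_, ?_⟩ <;> rw [ENNReal.ofReal_coe_nnreal]
  · exact ENNReal.coe_lt_coe.2 hsc
  · exact (ENNReal.coe_lt_coe.2 hcu).trans hut

end ValueGroup

section ResidueField

variable (K : Type*) [NormedField K] [IsUltrametricDist K]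

/-- The residue field of the valuation ring `{|z| ≤ 1}` of `K`. -/
abbrev ResidueField : Type _ :=
  IsLocalRing.ResidueField (NormedField.valuation (K := K)).valuationSubring

variable {K}

theorem mem_valuationSubring_iff_norm_le_one {u : K} :
    u ∈ (NormedField.valuation (K := K)).valuationSubring ↔ ‖u‖ ≤ 1 := by
  rw [Valuation.mem_valuationSubring_iff, NormedField.valuation_apply, ← NNReal.coe_le_coe]
  rfl

theorem residue_eq_zero_iff_norm_lt_one {u : (NormedField.valuation (K := K)).valuationSubring} :
    IsLocalRing.residue _ u = 0 ↔ ‖(u : K)‖ < 1 := by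
  rw [IsLocalRing.residue_eq_zero_iff, IsLocalRing.mem_maximalIdeal, mem_nonunits_iff]
  exact Valuation.Integer.not_isUnit_iff_valuation_lt_one (v := NormedField.valuation (K := K))

theorem exists_norm_sub_eq_max_one [Infinite (ResidueField K)] {A : Set K} (hA : A.Finite) :
    ∃ u : K, ∀ a ∈ A, ‖u - a‖ = max 1 ‖a‖ := by
  set O := (NormedField.valuation (K := K)).valuationSubring
  have hfin : (IsLocalRing.residue O '' (Subtype.val ⁻¹' A)).Finite :=
    (hA.preimage Subtype.val_injective.injOn).image _
  obtain ⟨y, hy⟩ := hfin.exists_notMem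
  obtain ⟨u, rfl⟩ := IsLocalRing.residue_surjective y
  have hu : ‖(u : K)‖ ≤ 1 := mem_valuationSubring_iff_norm_le_one.1 u.2
  refine ⟨u, fun a ha => ?_⟩
  rcases le_or_gt ‖a‖ 1 with ha1 | ha1
  · rw [max_eq_left ha1]
    lift a to O using mem_valuationSubring_iff_norm_le_one.2 ha1
    refine le_antisymm (mem_valuationSubring_iff_norm_le_one.1 (u - a).2) (not_lt.1 fun h => hy ?_)
    refine ⟨a, ha, (sub_eq_zero.1 ?_).symm⟩
    rw [← map_sub, residue_eq_zero_iff_norm_lt_one]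
    exact h
  · rw [sub_eq_add_neg, IsUltrametricDist.norm_add_eq_max_of_norm_ne_norm, norm_neg,
      max_eq_right (hu.trans ha1.le), max_eq_right ha1.le]
    rw [norm_neg]
    exact (hu.trans_lt ha1).ne

theorem exists_norm_sub_eq_max [Infinite (ResidueField K)] {A : Set K} (hA : A.Finite) (b : K)
    {s : ℝ} (hs : s ∈ valueGroup K) : ∃ x : K, ∀ a ∈ A, ‖x - a‖ = max s ‖b - a‖ := by
  obtain ⟨c, hc, rfl⟩ := hs
  obtain ⟨u, hu⟩ := exists_norm_sub_eq_max_one (hA.image fun a => (a - b) / c)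
  refine ⟨b + c * u, fun a ha => ?_⟩
  have hc0 : 0 < ‖c‖ := norm_pos_iff.2 hc
  calc ‖b + c * u - a‖ = ‖c * (u - (a - b) / c)‖ := by congr 1; field_simp; ring
    _ = ‖c‖ * max 1 ‖(a - b) / c‖ := by rw [norm_mul, hu _ (mem_image_of_mem _ ha)]
    _ = max ‖c‖ ‖b - a‖ := by
      rw [mul_max_of_nonneg _ _ hc0.le, mul_one, norm_div, mul_div_cancel₀ _ hc0.ne',
        norm_sub_rev]

end ResidueField

/-! ## The tree of `K` -/

section Tree

variable {K : Type*} [NormedField K] [IsUltrametricDist K]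

theorem continuous_supr_right (S : Arb K) : Continuous fun T : Arb K => supr S T :=
  continuous_supr.comp (Continuous.prodMk_right S)

theorem continuous_supr_left (S : Arb K) : Continuous fun T : Arb K => supr T S :=
  continuous_supr.comp (Continuous.prodMk_left S)

theorem supr_nonneg (S T : Arb K) : 0 ≤ supr S T := (diam_nonneg S).trans (diam_le_supr S T)

theorem dist_eq_supr_sub (S T : Arb K) : dist S T = supr S T - (diam S + diam T) / 2 := by
  rw [supr]; ring

theorem supr_pt_zero (a b : K) (r : ℝ≥0) : supr (pt b r) (pt a 0) = max (r : ℝ) (dist b a) := by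
  rw [supr_pt, NNReal.coe_zero, max_eq_left r.coe_nonneg]

theorem supr_pt_eq_max (S : Arb K) (a : K) (r : ℝ≥0) :
    supr S (pt a r) = max (supr S (pt a 0)) r :=
  isClosed_property denseRange_pt
    (isClosed_eq (continuous_supr_left _) ((continuous_supr_left _).max continuous_const))
    (fun p => by rw [supr_pt_zero, supr_pt, max_right_comm]) S

theorem eq_pt_of_supr_le_diam {S : Arb K} {a : K} {r : ℝ≥0} (hr : diam S = r)
    (h : supr S (pt a 0) ≤ diam S) : S = pt a r := by
  have hsup : supr S (pt a r) = r := by rw [supr_pt_eq_max, max_eq_right (hr ▸ h)]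
  rw [← dist_le_zero, dist_eq_supr_sub, hsup, diam_pt, hr]
  linarith

theorem eq_of_supr_eq {S T : Arb K} (h : ∀ a : K, supr S (pt a 0) = supr T (pt a 0)) : S = T := by
  have hsup : ∀ U, supr S U = supr T U :=
    isClosed_property denseRange_pt
      (isClosed_eq (continuous_supr_right _) (continuous_supr_right _))
      (fun p => by rw [supr_pt_eq_max, h, ← supr_pt_eq_max])
  have hS : diam S = supr S T := by rw [← supr_self, hsup, supr_comm]
  have hT : diam T = supr S T := by rw [← supr_self, hsup]
  rw [← dist_le_zero, dist_eq_supr_sub, hS, hT]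
  linarith

theorem exists_supr_lt {S : Arb K} {r : ℝ} (h : diam S < r) : ∃ b : K, supr S (pt b 0) < r := by
  obtain ⟨p, hp⟩ := denseRange_pt.exists_mem_open
    (isOpen_lt (continuous_supr_right S) continuous_const) ⟨S, (supr_self S).trans_lt h⟩
  rw [mem_ofPred_eq, supr_pt_eq_max] at hp
  exact ⟨p.center, (le_max_left _ _).trans_lt hp⟩

theorem dist_pt_same_center (a : K) (r s : ℝ≥0) : dist (pt a r) (pt a s) = dist r s / 2 := by
  rw [dist_pt, dist_self, max_eq_left (le_max_of_le_left r.coe_nonneg), NNReal.dist_eq]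
  grind

theorem continuous_pt (a : K) : Continuous (pt a) := by
  refine LipschitzWith.continuous (K := 1) (LipschitzWith.of_dist_le_mul fun r s => ?_)
  rw [dist_pt_same_center, NNReal.coe_one, one_mul]
  exact half_le_self dist_nonneg

end Tree

/-! ## The functions `|P - a|` -/

section AbsSub

variable {K : Type*} [NormedField K] [IsUltrametricDist K]

/-- The function `|P - a|` on the projective tree, with values in `[0, ∞]`: it is `sup {S, [a, 0]}`
at a point `S` of the tree, and `∞` at `∞`. On `K` it is `|x - a|`. -/
noncomputable def absSub (a : K) : ArbP K → ℝ≥0∞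
  | .of S => ENNReal.ofReal (supr S (pt a 0))
  | .infty => ⊤

theorem absSub_of (a : K) (S : Arb K) : absSub a (.of S) = ENNReal.ofReal (supr S (pt a 0)) := rfl

@[simp] theorem absSub_infty (a : K) : absSub a .infty = ⊤ := rfl

@[simp] theorem absSub_pt (a b : K) (r : ℝ≥0) :
    absSub a (.of (pt b r)) = max (r : ℝ≥0∞) (edist b a) := by
  rw [absSub_of, supr_pt_zero, ENNReal.ofReal_max, ENNReal.ofReal_coe_nnreal, edist_dist]

theorem absSub_le_max (a b : K) (P : ArbP K) : absSub a P ≤ max (absSub b P) (edist b a) := by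
  rcases P with S | _
  · rw [absSub_of, absSub_of, edist_dist, ← ENNReal.ofReal_max]
    refine ENNReal.ofReal_le_ofReal ((supr_le_max _ (pt b 0) _).trans ?_)
    rw [supr_pt_zero, NNReal.coe_zero, max_eq_right dist_nonneg]
  · simp

theorem edist_le_max_absSub (a b : K) (P : ArbP K) :
    edist b a ≤ max (absSub b P) (absSub a P) := by
  rcases P with S | _
  · rw [absSub_of, absSub_of, edist_dist, ← ENNReal.ofReal_max]
    refine ENNReal.ofReal_le_ofReal ?_
    calc dist b a ≤ supr (pt b 0) (pt a 0) := by rw [supr_pt_zero]; exact le_max_right _ _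
      _ ≤ max (supr S (pt b 0)) (supr S (pt a 0)) := by
        rw [supr_comm S (pt b 0)]; exact supr_le_max _ _ _
  · simp

theorem eq_of_absSub_eq {P Q : ArbP K} (h : ∀ a, absSub a P = absSub a Q) : P = Q := by
  rcases P with S | _ <;> rcases Q with T | _
  · congr 1
    refine eq_of_supr_eq fun a => ?_
    rw [← ENNReal.ofReal_eq_ofReal_iff (supr_nonneg _ _) (supr_nonneg _ _)]
    exact h a
  · exact absurd (h 0) ENNReal.ofReal_ne_top
  · exact absurd (h 0).symm ENNReal.ofReal_ne_top
  · rfl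

theorem absSub_eq_of_lt {a b : K} {P Q : ArbP K} (hP : absSub b P < absSub a P)
    (hQ : absSub b Q < absSub a P) : absSub a Q = absSub a P := by
  have hle : absSub a P ≤ edist b a :=
    (le_max_iff.1 (absSub_le_max a b P)).resolve_left hP.not_ge
  have hge : edist b a ≤ absSub a P := (edist_le_max_absSub a b P).trans (max_le hP.le le_rfl)
  refine le_antisymm ((absSub_le_max a b Q).trans (max_le hQ.le hge)) ?_
  exact (le_max_iff.1 (hle.trans (edist_le_max_absSub a b Q))).resolve_left hQ.not_ge

/-- The path `t ↦ [a, t]` from `a` to `∞` in the projective tree. -/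
noncomputable def ray (a : K) (t : ℝ≥0∞) : ArbP K :=
  if t = ⊤ then .infty else .of (pt a t.toNNReal)

@[simp] theorem ray_coe (a : K) (t : ℝ≥0) : ray a t = .of (pt a t) := by simp [ray]

@[simp] theorem ray_top (a : K) : ray a ⊤ = .infty := by simp [ray]

theorem absSub_ray (a b : K) (t : ℝ≥0∞) : absSub a (ray b t) = max t (edist b a) := by
  induction t with
  | top => simp
  | coe t => simp

@[simp] theorem absSub_ray_self (a : K) (t : ℝ≥0∞) : absSub a (ray a t) = t := by
  rw [absSub_ray, edist_self, max_eq_left zero_le]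

theorem ray_eq_ray {a b : K} {t : ℝ≥0∞} (h : edist b a ≤ t) : ray b t = ray a t := by
  have hle : ∀ {a b : K}, edist b a ≤ t → ∀ c, absSub c (ray b t) ≤ absSub c (ray a t) := by
    intro a b h c
    calc absSub c (ray b t) ≤ max (absSub a (ray b t)) (edist a c) := absSub_le_max c a _
      _ = absSub c (ray a t) := by rw [absSub_ray, absSub_ray, max_eq_left h]
  exact eq_of_absSub_eq fun c => le_antisymm (hle h c) (hle (by rwa [edist_comm]) c)

theorem eq_ray_or_exists_absSub_lt (a : K) (P : ArbP K) :
    P = ray a (absSub a P) ∨ ∃ b, absSub b P < absSub a P := by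
  rcases P with S | _
  · rcases (diam_le_supr S (pt a 0)).eq_or_lt with heq | hlt
    · left
      rw [absSub_of, ENNReal.ofReal, ray_coe]
      congr 1
      exact eq_pt_of_supr_le_diam (by rw [heq, Real.coe_toNNReal _ (supr_nonneg _ _)]) heq.ge
    · right
      obtain ⟨b, hb⟩ := exists_supr_lt hlt
      exact ⟨b, (ENNReal.ofReal_lt_ofReal_iff_of_nonneg (supr_nonneg _ _)).2 hb⟩
  · simp

end AbsSub

/-! ## Continuity for the chordal distance -/

section Chordal

variable {K : Type*} [NormedField K] [IsUltrametricDist K]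

theorem chordalSup_sub_le (P Q R : ArbP K) : chordalSup P R - chordalSup Q R ≤ 2 * dist P Q := by
  have hdist : dist P Q = chordalSup P Q - chordalSup P P / 2 - chordalSup Q Q / 2 :=
    chordal_eq P Q
  have hP := chordalSup_self_le P Q
  have hQ := chordalSup_self_le Q R
  have hd : 0 ≤ dist P Q := dist_nonneg
  rcases le_max_iff.1 (chordalSup_le_max P Q R) with h | h <;> linarith

theorem continuous_chordalSup_left (R : ArbP K) : Continuous fun P : ArbP K => chordalSup P R := by
  refine LipschitzWith.continuous (K := 2) (LipschitzWith.of_dist_le_mul fun P Q => ?_)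
  rw [Real.dist_eq, abs_le, NNReal.coe_ofNat]
  have hPQ := chordalSup_sub_le P Q R
  have hQP := chordalSup_sub_le Q P R
  rw [dist_comm Q P] at hQP
  constructor <;> linarith

theorem max_one_abv_pos (S : Arb K) : 0 < max 1 (abv S) := lt_max_of_lt_left one_pos

theorem absSub_eq_chordalSup_div (a : K) (P : ArbP K) :
    absSub a P = ENNReal.ofReal (chordalSup P (.of (pt a 0)) * max 1 (abv (pt a 0))) /
      ENNReal.ofReal (chordalSup P .infty) := by
  rcases P with S | _
  · simp only [chordalSup]
    rw [← ENNReal.ofReal_div_of_pos (by positivity), absSub_of]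
    congr 1
    field_simp
  · simp [chordalSup, (max_one_abv_pos (pt a 0)).ne']

theorem continuous_absSub (a : K) : Continuous (absSub a) := by
  rw [funext (absSub_eq_chordalSup_div a), continuous_iff_continuousAt]
  intro P
  refine ENNReal.Tendsto.div
    ((ENNReal.continuous_ofReal.comp ((continuous_chordalSup_left _).mul_const _)).tendsto P)
    ?_ ((ENNReal.continuous_ofReal.comp (continuous_chordalSup_left _)).tendsto P)
    (.inl ENNReal.ofReal_ne_top)
  rcases P with S | _
  · exact .inr (ENNReal.ofReal_pos.2 (by simp only [chordalSup]; positivity)).ne'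
  · exact .inl (ENNReal.ofReal_pos.2 (by simp only [chordalSup]; positivity)).ne'

theorem continuous_of : Continuous (ArbP.of : Arb K → ArbP K) := by
  refine continuous_iff_continuousAt.2 fun S => tendsto_iff_dist_tendsto_zero.2 ?_
  have hM : Continuous fun T : Arb K => max 1 (abv T) :=
    continuous_const.max (continuous_supr_left _)
  have hM0 : ∀ T : Arb K, max 1 (abv T) ≠ 0 := fun T => (max_one_abv_pos T).ne'
  have hc : Continuous fun T : Arb K => supr T S / (max 1 (abv T) * max 1 (abv S)) -
      diam T / max 1 (abv T) ^ 2 / 2 - diam S / max 1 (abv S) ^ 2 / 2 :=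
    (((continuous_supr_left S).div (hM.mul continuous_const) fun T =>
      mul_ne_zero (hM0 T) (hM0 S)).sub ((continuous_diam.div (hM.pow 2) fun T =>
        pow_ne_zero 2 (hM0 T)).div_const 2)).sub continuous_const
  rw [← dist_self (ArbP.of S)]
  exact hc.tendsto S

theorem dist_ray_infty_le (a : K) {t : ℝ≥0∞} (ht : t ≠ 0) : dist (ray a t) .infty ≤ t⁻¹.toReal := by
  induction t with
  | top => simp
  | coe t =>
    have ht' : 0 < (t : ℝ) := NNReal.coe_pos.2 (pos_iff_ne_zero.2 (by simpa using ht))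
    have hdiam : 0 ≤ diam (pt a t) / max 1 (abv (pt a t)) ^ 2 / 2 := by
      have := diam_nonneg (pt a t)
      positivity
    calc dist (ray a t) .infty
        = 1 / max 1 (abv (pt a t)) - diam (pt a t) / max 1 (abv (pt a t)) ^ 2 / 2 := by
          rw [ray_coe]; rfl
      _ ≤ 1 / max 1 (abv (pt a t)) := sub_le_self _ hdiam
      _ ≤ 1 / t := one_div_le_one_div_of_le ht' (le_max_of_le_right (by
          rw [abv_pt]; exact le_max_right _ _))
      _ = (t : ℝ≥0∞)⁻¹.toReal := by rw [ENNReal.toReal_inv, ENNReal.coe_toReal, one_div]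

theorem continuous_ray (a : K) : Continuous (ray a) := by
  refine continuous_iff_continuousAt.2 fun t => ?_
  induction t with
  | top =>
    rw [ContinuousAt, ray_top, tendsto_iff_dist_tendsto_zero]
    have hinv : Tendsto (fun t : ℝ≥0∞ => t⁻¹.toReal) (𝓝 ⊤) (𝓝 0) := by
      refine (ENNReal.tendsto_toReal ENNReal.zero_ne_top).comp ?_
      rw [← ENNReal.inv_top]
      exact continuous_inv.tendsto ⊤
    refine squeeze_zero' (Eventually.of_forall fun _ => dist_nonneg) ?_ hinv
    filter_upwards [eventually_ne_nhds ENNReal.top_ne_zero] with t ht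
    exact dist_ray_infty_le a ht
  | coe t =>
    rw [ENNReal.continuousAt_coe_iff]
    have : ray a ∘ ((↑) : ℝ≥0 → ℝ≥0∞) = fun t => .of (pt a t) := funext (ray_coe a)
    rw [this]
    exact (continuous_of.comp (continuous_pt a)).continuousAt

theorem denseRange_ray : DenseRange fun p : K × ℝ≥0∞ => ray p.1 p.2 := by
  rintro (S | _)
  · refine closure_mono ?_ (image_closure_subset_closure_image continuous_of
      ⟨S, denseRange_pt S, rfl⟩)
    rintro _ ⟨_, ⟨p, rfl⟩, rfl⟩
    exact ⟨(p.center, p.radius), ray_coe _ _⟩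
  · exact subset_closure ⟨(0, ⊤), ray_top 0⟩

theorem denseRange_pt_pos :
    DenseRange fun p : K × {r : ℝ≥0 // 0 < r} => ArbP.of (pt p.1 p.2) := by
  refine dense_closure.1 (denseRange_ray.mono ?_)
  rintro _ ⟨⟨x, t⟩, rfl⟩
  have ht : t ∈ closure (Ioo (0 : ℝ≥0∞) ⊤) := by
    rw [closure_Ioo ENNReal.zero_lt_top.ne]
    exact ⟨zero_le, le_top⟩
  refine closure_mono ?_ (image_closure_subset_closure_image (continuous_ray x) ⟨t, ht, rfl⟩)
  rintro _ ⟨t, ⟨h0, htop⟩, rfl⟩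
  lift t to ℝ≥0 using htop.ne
  exact ⟨(x, ⟨t, ENNReal.coe_pos.1 h0⟩), (ray_coe x t).symm⟩

end Chordal

/-! ## The weak topology of the projective tree -/

section WeakTree

variable (K : Type*) [NormedField K] [IsUltrametricDist K]

/-- The weak topology of the projective tree: the coarsest one for which the functions `|P - a|`
are continuous. It corresponds to the weak topology of `Ber K`. -/
@[reducible] noncomputable def weakTree : TopologicalSpace (ArbP K) :=
  .induced (fun P a => absSub a P) Pi.topologicalSpace

/-- The topology of the projective tree given by the chordal distance. -/
noncomputable abbrev fineTree : TopologicalSpace (ArbP K) := inferInstance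

theorem fineTree_le_weakTree : fineTree K ≤ weakTree K :=
  continuous_iff_le_induced.1 (continuous_pi continuous_absSub)

variable {K}

theorem continuous_weakTree_absSub (a : K) : Continuous[weakTree K, _] (absSub a) :=
  let _ := weakTree K
  (continuous_pi_iff (f := fun P a => absSub a P)).1 continuous_induced_dom a

theorem tendsto_nhds_weakTree {X : Type*} {f : X → ArbP K} {l : Filter X} {P : ArbP K} :
    Tendsto f l (@nhds _ (weakTree K) P) ↔
      ∀ a, Tendsto (fun x => absSub a (f x)) l (𝓝 (absSub a P)) := by
  rw [nhds_induced, tendsto_comap_iff, tendsto_pi_nhds]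
  rfl

theorem t2Space_weakTree : @T2Space _ (weakTree K) :=
  let _ := weakTree K
  .of_injective_continuous (fun _ _ h => eq_of_absSub_eq (congrFun h)) continuous_induced_dom

theorem eventually_absSub_eq {a : K} {P : ArbP K} (h : P ≠ ray a (absSub a P)) :
    ∀ᶠ Q in @nhds _ (weakTree K) P, absSub a Q = absSub a P := by
  let _ := weakTree K
  obtain ⟨b, hb⟩ := (eq_ray_or_exists_absSub_lt a P).resolve_left h
  filter_upwards [(continuous_weakTree_absSub b).continuousAt.eventually_lt continuousAt_const hb]
    with Q hQ
  exact absSub_eq_of_lt hb hQ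

theorem absSub_preimage_subset_closure_interior (a : K) {I : Set ℝ≥0∞}
    (hI : I ⊆ closure (interior I)) :
    absSub a ⁻¹' I ⊆ @closure _ (weakTree K) (@interior _ (weakTree K) (absSub a ⁻¹' I)) := by
  intro P hP
  let _ := weakTree K
  have ha : Continuous (absSub a) := continuous_weakTree_absSub a
  by_cases hray : P = ray a (absSub a P)
  · have hc : Continuous (ray a) := continuous_le_rng (fineTree_le_weakTree K) (continuous_ray a)
    rw [hray]
    refine closure_mono (preimage_interior_subset_interior_preimage ha) ?_
    refine closure_mono ?_ (image_closure_subset_closure_image hc ⟨_, hI hP, rfl⟩)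
    rintro _ ⟨t, ht, rfl⟩
    rwa [mem_preimage, absSub_ray_self]
  · refine subset_closure (mem_interior_iff_mem_nhds.2 ?_)
    filter_upwards [eventually_absSub_eq hray] with Q hQ
    rwa [mem_preimage, hQ]

theorem frontier_absSub_preimage (a : K) (I : Set ℝ≥0∞) {τ : TopologicalSpace (ArbP K)}
    (hfine : fineTree K ≤ τ) (hweak : τ ≤ weakTree K) :
    @frontier _ τ (absSub a ⁻¹' I) = ray a '' frontier I := by
  have ha : Continuous[τ, _] (absSub a) := continuous_le_dom hweak (continuous_weakTree_absSub a)
  have hc : Continuous[_, τ] (ray a) := continuous_le_rng hfine (continuous_ray a)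
  refine Subset.antisymm (fun P hP => ?_) ?_
  · have hPI := ha.frontier_preimage_subset _ hP
    by_contra hnot
    have hloc : ∀ᶠ Q in @nhds _ τ P, absSub a Q = absSub a P :=
      nhds_mono hweak (eventually_absSub_eq fun h => hnot ⟨_, hPI, h.symm⟩)
    rw [frontier_eq_closure_inter_closure, mem_inter_iff, mem_closure_iff_frequently,
      mem_closure_iff_frequently] at hP
    obtain ⟨Q, hQI, hQ⟩ := (hP.1.and_eventually hloc).exists
    obtain ⟨R, hRI, hR⟩ := (hP.2.and_eventually hloc).exists
    exact hRI (show absSub a R ∈ I by rwa [hR, ← hQ])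
  · have key : ∀ J : Set ℝ≥0∞, ray a '' closure J ⊆ closure[τ] (absSub a ⁻¹' J) := fun J =>
      (image_closure_subset_closure_image hc).trans (closure_mono (by
        rintro _ ⟨t, ht, rfl⟩
        rwa [mem_preimage, absSub_ray_self]))
    rw [frontier_eq_closure_inter_closure, frontier_eq_closure_inter_closure]
    exact (image_inter_subset _ _ _).trans (inter_subset_inter (key I) (key Iᶜ))

end WeakTree

/-! ## Connectedness -/

section Connected

variable {K : Type*} [NormedField K] [IsUltrametricDist K]

theorem absSub_fiber_subset_closure_ray (a : K) (t : ℝ≥0∞) :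
    {P | absSub a P = t} ⊆ closure {P | (∃ b s, P = ray b s) ∧ absSub a P = t} := by
  rintro P rfl
  by_cases hray : P = ray a (absSub a P)
  · exact subset_closure ⟨⟨a, _, hray⟩, rfl⟩
  · have hloc := nhds_mono (fineTree_le_weakTree K) (eventually_absSub_eq hray)
    refine mem_closure_iff_frequently.2 (((mem_closure_iff_frequently.1
      (denseRange_ray P)).and_eventually hloc).mono ?_)
    rintro _ ⟨⟨p, rfl⟩, h⟩
    exact ⟨⟨p.1, p.2, rfl⟩, h⟩

/-- The points `[b, s]` of the fibre of `t` are joined to `[a, t]` by their rays, and they are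
dense in it. -/
theorem isPreconnected_absSub_fiber (a : K) (t : ℝ≥0∞) : IsPreconnected {P | absSub a P = t} := by
  refine IsPreconnected.subset_closure (isPreconnected_of_forall (ray a t) ?_) (fun P h => h.2)
    (absSub_fiber_subset_closure_ray a t)
  rintro _ ⟨⟨b, s, rfl⟩, h⟩
  rw [absSub_ray] at h
  have hst : s ≤ t := h ▸ le_max_left _ _
  have hbt : edist b a ≤ t := h ▸ le_max_right _ _
  refine ⟨ray b '' Icc s t, ?_, ⟨t, ⟨hst, le_rfl⟩, ray_eq_ray hbt⟩, ⟨s, ⟨le_rfl, hst⟩, rfl⟩,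
    isPreconnected_Icc.image _ (continuous_ray b).continuousOn⟩
  rintro _ ⟨u, ⟨hu, hut⟩, rfl⟩
  refine ⟨⟨b, u, rfl⟩, ?_⟩
  rw [absSub_ray]
  exact le_antisymm (max_le hut hbt) (h ▸ max_le_max_right _ hu)

theorem isConnected_absSub_preimage (a : K) {I : Set ℝ≥0∞} (hI : I.OrdConnected)
    (hne : I.Nonempty) : IsConnected (absSub a ⁻¹' I) := by
  obtain ⟨t, ht⟩ := hne
  refine ⟨⟨ray a t, by rwa [mem_preimage, absSub_ray_self]⟩,
    isPreconnected_of_forall (ray a t) fun P hP => ?_⟩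
  have hrayI : IsPreconnected (ray a '' I) :=
    hI.isPreconnected.image _ (continuous_ray a).continuousOn
  refine ⟨ray a '' I ∪ {Q | absSub a Q = absSub a P}, ?_, .inl ⟨t, ht, rfl⟩, .inr rfl,
    hrayI.union (ray a (absSub a P)) ⟨_, hP, rfl⟩ (absSub_ray_self _ _)
      (isPreconnected_absSub_fiber a _)⟩
  rintro _ (⟨u, hu, rfl⟩ | h)
  · rwa [mem_preimage, absSub_ray_self]
  · rwa [mem_preimage, h]

end Connected

/-! ## Balls and affinoids of the projective line as traces -/

section HalfLine

/-- Open half-lines of `[0, ∞]` with endpoint `r`. -/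
def IsOpenHalfLine (r : ℝ≥0∞) (I : Set ℝ≥0∞) : Prop := I = Iio r ∨ I = Ioi r

/-- Closed half-lines of `[0, ∞]` with endpoint `r`. -/
def IsClosedHalfLine (r : ℝ≥0∞) (I : Set ℝ≥0∞) : Prop := I = Iic r ∨ I = Ici r

/-- Half-lines of `[0, ∞]` with endpoint `r`, which may or may not contain `r`. -/
def IsHalfLine (r : ℝ≥0∞) (I : Set ℝ≥0∞) : Prop := IsOpenHalfLine r I ∨ IsClosedHalfLine r I

variable {r : ℝ≥0∞} {I : Set ℝ≥0∞}

theorem IsOpenHalfLine.isOpen (h : IsOpenHalfLine r I) : IsOpen I := by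
  rcases h with rfl | rfl
  exacts [isOpen_Iio, isOpen_Ioi]

theorem IsClosedHalfLine.isClosed (h : IsClosedHalfLine r I) : IsClosed I := by
  rcases h with rfl | rfl
  exacts [isClosed_Iic, isClosed_Ici]

theorem IsOpenHalfLine.compl (h : IsOpenHalfLine r I) : IsClosedHalfLine r Iᶜ := by
  rcases h with rfl | rfl
  exacts [.inr compl_Iio, .inl compl_Ioi]

theorem IsClosedHalfLine.subset_closure_interior (h : IsClosedHalfLine r I) (h0 : r ≠ 0)
    (htop : r ≠ ⊤) : I ⊆ closure (interior I) := by
  rcases h with rfl | rfl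
  · rw [interior_Iic' ⟨⊤, htop.lt_top⟩, closure_Iio' ⟨0, pos_iff_ne_zero.2 h0⟩]
  · rw [interior_Ici' ⟨0, pos_iff_ne_zero.2 h0⟩, closure_Ioi' ⟨⊤, htop.lt_top⟩]

theorem IsHalfLine.ordConnected (h : IsHalfLine r I) : I.OrdConnected := by
  rcases h with (rfl | rfl) | rfl | rfl
  exacts [ordConnected_Iio, ordConnected_Ioi, ordConnected_Iic, ordConnected_Ici]

theorem IsHalfLine.frontier_eq (h : IsHalfLine r I) (h0 : r ≠ 0) (htop : r ≠ ⊤) :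
    frontier I = {r} := by
  have hbot : (Iio r).Nonempty := ⟨0, pos_iff_ne_zero.2 h0⟩
  have htop : (Ioi r).Nonempty := ⟨⊤, htop.lt_top⟩
  rcases h with (rfl | rfl) | rfl | rfl
  exacts [frontier_Iio' hbot, frontier_Ioi' htop, frontier_Iic' htop, frontier_Ici' hbot]

theorem IsHalfLine.nonempty (h : IsHalfLine r I) (h0 : r ≠ 0) (htop : r ≠ ⊤) : I.Nonempty := by
  refine nonempty_iff_ne_empty.2 fun hI => singleton_ne_empty r ?_
  rw [← h.frontier_eq h0 htop, hI, frontier_empty]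

end HalfLine

section Classical

variable {K : Type*} [NormedField K] [IsUltrametricDist K]

/-- The points of the projective line, seen in the projective tree. -/
noncomputable def classical : P1 K → ArbP K
  | (x : K) => .of (pt x 0)
  | OnePoint.infty => .infty

@[simp] theorem classical_coe (x : K) : classical (x : P1 K) = .of (pt x 0) := rfl

@[simp] theorem classical_infty : classical (OnePoint.infty : P1 K) = .infty := rfl

theorem absSub_classical_coe (a x : K) :
    absSub a (classical (x : P1 K)) = ENNReal.ofReal ‖x - a‖ := by
  rw [classical_coe, absSub_pt, ENNReal.coe_zero, max_eq_right zero_le, edist_dist, dist_eq_norm]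

theorem toP1_norm_sub_lt (a : K) {r : ℝ} (hr : 0 < r) :
    toP1 {z | ‖z - a‖ < r} = classical ⁻¹' (absSub a ⁻¹' Iio (ENNReal.ofReal r)) := by
  ext x
  induction x using OnePoint.rec with
  | infty => simp [toP1]
  | coe x =>
    rw [mem_preimage, mem_preimage, absSub_classical_coe, mem_Iio, ENNReal.ofReal_lt_ofReal_iff hr]
    simp [toP1]

theorem toP1_norm_sub_le (a : K) {r : ℝ} (hr : 0 < r) :
    toP1 {z | ‖z - a‖ ≤ r} = classical ⁻¹' (absSub a ⁻¹' Iic (ENNReal.ofReal r)) := by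
  ext x
  induction x using OnePoint.rec with
  | infty => simp [toP1]
  | coe x =>
    rw [mem_preimage, mem_preimage, absSub_classical_coe, mem_Iic,
      ENNReal.ofReal_le_ofReal_iff hr.le]
    simp [toP1]

theorem compl_toP1_norm_sub_lt (a : K) {r : ℝ} (hr : 0 < r) :
    (toP1 {z | ‖z - a‖ < r})ᶜ = classical ⁻¹' (absSub a ⁻¹' Ici (ENNReal.ofReal r)) := by
  rw [toP1_norm_sub_lt a hr, ← preimage_compl, ← preimage_compl, compl_Iio]

theorem compl_toP1_norm_sub_le (a : K) {r : ℝ} (hr : 0 < r) :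
    (toP1 {z | ‖z - a‖ ≤ r})ᶜ = classical ⁻¹' (absSub a ⁻¹' Ioi (ENNReal.ofReal r)) := by
  rw [toP1_norm_sub_le a hr, ← preimage_compl, ← preimage_compl, compl_Iic]

theorem isOpenBall_iff {B : Set (P1 K)} : IsOpenBall B ↔ ∃ a, ∃ r ∈ valueGroup K,
    ∃ I, IsOpenHalfLine (ENNReal.ofReal r) I ∧ B = classical ⁻¹' (absSub a ⁻¹' I) := by
  constructor
  · rintro ⟨D, ⟨⟨a, r, hr, rfl⟩, rfl⟩ | ⟨⟨a, r, hr, rfl⟩, rfl⟩⟩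
    · exact ⟨a, r, hr, _, .inl rfl, toP1_norm_sub_lt a (pos_of_mem_valueGroup hr)⟩
    · exact ⟨a, r, hr, _, .inr rfl, compl_toP1_norm_sub_le a (pos_of_mem_valueGroup hr)⟩
  · rintro ⟨a, r, hr, I, rfl | rfl, rfl⟩
    · exact ⟨_, .inl ⟨⟨a, r, hr, rfl⟩, (toP1_norm_sub_lt a (pos_of_mem_valueGroup hr)).symm⟩⟩
    · exact ⟨_, .inr ⟨⟨a, r, hr, rfl⟩, (compl_toP1_norm_sub_le a (pos_of_mem_valueGroup hr)).symm⟩⟩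

theorem IsClosedBall.exists_halfLine {B : Set (P1 K)} (hB : IsClosedBall B) : ∃ a r, 0 < r ∧
    ∃ I, IsClosedHalfLine (ENNReal.ofReal r) I ∧ B = classical ⁻¹' (absSub a ⁻¹' I) := by
  obtain ⟨D, ⟨⟨a, r, hr, rfl⟩, rfl⟩ | ⟨⟨a, r, hr, rfl⟩, rfl⟩⟩ := hB
  · exact ⟨a, r, pos_of_mem_valueGroup hr, _, .inl rfl,
      toP1_norm_sub_le a (pos_of_mem_valueGroup hr)⟩
  · exact ⟨a, r, pos_of_mem_valueGroup hr, _, .inr rfl,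
      compl_toP1_norm_sub_lt a (pos_of_mem_valueGroup hr)⟩

omit [IsUltrametricDist K] in
theorem setOf_norm_sub_lt_eq_le_of_notMem_valueGroup (a : K) {r : ℝ} (hr : 0 < r)
    (hrK : r ∉ valueGroup K) : {z | ‖z - a‖ < r} = {z | ‖z - a‖ ≤ r} := by
  have hne : ∀ z, ‖z - a‖ ≠ r := fun z h => hrK ⟨z - a, norm_pos_iff.1 (h.symm ▸ hr), h⟩
  exact ext fun z => (Ne.le_iff_lt (hne z)).symm

theorem IsIrrationalBall.exists_openHalfLine {B : Set (P1 K)} (hB : IsIrrationalBall B) :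
    ∃ a r, 0 < r ∧ ∃ I, IsOpenHalfLine (ENNReal.ofReal r) I ∧
      B = classical ⁻¹' (absSub a ⁻¹' I) := by
  obtain ⟨D, ⟨a, r, hr, hrK, rfl⟩, rfl | rfl⟩ := hB
  · exact ⟨a, r, hr, _, .inl rfl, toP1_norm_sub_lt a hr⟩
  · rw [setOf_norm_sub_lt_eq_le_of_notMem_valueGroup a hr hrK]
    exact ⟨a, r, hr, _, .inr rfl, compl_toP1_norm_sub_le a hr⟩

theorem IsIrrationalBall.exists_closedHalfLine {B : Set (P1 K)} (hB : IsIrrationalBall B) :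
    ∃ a r, 0 < r ∧ ∃ I, IsClosedHalfLine (ENNReal.ofReal r) I ∧
      B = classical ⁻¹' (absSub a ⁻¹' I) := by
  obtain ⟨D, ⟨a, r, hr, hrK, rfl⟩, rfl | rfl⟩ := hB
  · rw [setOf_norm_sub_lt_eq_le_of_notMem_valueGroup a hr hrK]
    exact ⟨a, r, hr, _, .inl rfl, toP1_norm_sub_le a hr⟩
  · exact ⟨a, r, hr, _, .inr rfl, compl_toP1_norm_sub_lt a hr⟩

end Classical

section Affinoid

variable {K : Type*} [NormedField K] [IsUltrametricDist K]

/-- Open balls of the projective tree whose radius belongs to the value group: their traces on the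
projective line are its open balls. -/
def IsOpenTreeBall (G : Set (ArbP K)) : Prop :=
  ∃ a, ∃ r ∈ valueGroup K, ∃ I, IsOpenHalfLine (ENNReal.ofReal r) I ∧ G = absSub a ⁻¹' I

theorem IsOpenTreeBall.isOpen {G : Set (ArbP K)} (hG : IsOpenTreeBall G) :
    IsOpen[weakTree K] G := by
  let _ := weakTree K
  obtain ⟨a, r, -, I, hI, rfl⟩ := hG
  exact hI.isOpen.preimage (continuous_weakTree_absSub a)

theorem IsOpenAffinoid.exists_openTreeBalls {Y : Set (P1 K)} (hY : IsOpenAffinoid Y) :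
    ∃ T : Set (Set (ArbP K)), T.Finite ∧ (∀ G ∈ T, IsOpenTreeBall G) ∧
      Y = classical ⁻¹' ⋂₀ T := by
  obtain ⟨S, hS, hSb, rfl⟩ := hY
  have hlift : ∀ B ∈ S, ∃ G, IsOpenTreeBall G ∧ B = classical ⁻¹' G := by
    intro B hB
    obtain ⟨a, r, hr, I, hI, rfl⟩ := isOpenBall_iff.1 (hSb B hB)
    exact ⟨_, ⟨a, r, hr, I, hI, rfl⟩, rfl⟩
  choose! f hf hBf using hlift
  refine ⟨f '' S, hS.image f, forall_mem_image.2 hf, ?_⟩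
  rw [preimage_sInter, biInter_image, sInter_eq_biInter]
  exact iInter₂_congr hBf

/-- For `‖x‖` close to `s` and greater than `s`, the point `b + x` is close to `[b, s]`. -/
theorem tendsto_classical_add (b : K) (s : ℝ≥0) :
    Tendsto (fun x : K => classical ((b + x : K) : P1 K)) (comap norm (𝓝[>] (s : ℝ)))
      (@nhds _ (weakTree K) (.of (pt b s))) := by
  refine tendsto_nhds_weakTree.2 fun a => ?_
  have hnorm : Tendsto (fun x : K => ‖x‖) (comap norm (𝓝[>] (s : ℝ))) (𝓝[>] (s : ℝ)) :=
    tendsto_comap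
  have hne : ∀ᶠ t in 𝓝[>] (s : ℝ), t ≠ ‖b - a‖ := by
    rcases lt_or_ge (s : ℝ) ‖b - a‖ with h | h
    · exact (eventually_nhdsWithin_of_eventually_nhds (Iio_mem_nhds h)).mono fun t ht => ht.ne
    · exact eventually_mem_nhdsWithin.mono fun t ht => (h.trans_lt ht).ne'
  have hlim : Tendsto (fun x : K => ENNReal.ofReal (max ‖x‖ ‖b - a‖)) (comap norm (𝓝[>] (s : ℝ)))
      (𝓝 (absSub a (.of (pt b s)))) := by
    rw [absSub_of, supr_pt_zero, dist_eq_norm]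
    exact (ENNReal.continuous_ofReal.comp (continuous_id.max continuous_const)).tendsto (s : ℝ)
      |>.comp (hnorm.mono_right nhdsWithin_le_nhds)
  refine hlim.congr' ((hnorm.eventually hne).mono fun x hx => ?_)
  dsimp only
  rw [absSub_classical_coe, add_sub_right_comm, add_comm,
    IsUltrametricDist.norm_add_eq_max_of_norm_ne_norm hx]

theorem denseRange_classical [DenseValues K] :
    @DenseRange _ (weakTree K) _ (classical : P1 K → ArbP K) := by
  have hclosed : IsClosed (@closure _ (weakTree K) (range (classical : P1 K → ArbP K))) :=
    IsClosed.mono (t₂ := weakTree K) (@isClosed_closure _ (weakTree K) _) (fineTree_le_weakTree K)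
  refine fun P => closure_minimal ?_ hclosed (denseRange_pt_pos P)
  rintro _ ⟨⟨b, s, hs⟩, rfl⟩
  have : (comap (norm : K → ℝ) (𝓝[>] (s : ℝ))).NeBot := by
    refine comap_neBot fun t ht => ?_
    obtain ⟨u, hu, hut⟩ := mem_nhdsGT_iff_exists_Ioo_subset.1 ht
    obtain ⟨_, ⟨c, -, rfl⟩, hsc, hcu⟩ :=
      DenseValues.exists_mem_valueGroup_between (K := K) s.coe_nonneg hu
    exact ⟨c, hut ⟨hsc, hcu⟩⟩
  let _ := weakTree K
  exact mem_closure_of_tendsto (tendsto_classical_add b s)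
    (Eventually.of_forall fun x => mem_range_self _)

theorem exists_absSub_classical_eq [Infinite (ResidueField K)] {A : Set K} (hA : A.Finite) (b : K)
    {s : ℝ} (hs : s ∈ valueGroup K) :
    ∃ x : P1 K, ∀ a ∈ A, absSub a (classical x) = absSub a (ray b (ENNReal.ofReal s)) := by
  obtain ⟨x, hx⟩ := exists_norm_sub_eq_max hA b hs
  refine ⟨x, fun a ha => ?_⟩
  rw [absSub_classical_coe, hx a ha, absSub_ray, ENNReal.ofReal_max, edist_dist, dist_eq_norm]

/-- Outside the boundaries of the given balls this follows from the density of the classical points.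
The boundary points are of the form `[b, s]` with `s` in the value group, and among the infinitely
many residue classes of `{|x - b| ≤ s}` there is one that avoids all the centers. -/
theorem exists_classical_mem_iff [DenseValues K] [Infinite (ResidueField K)] (P : ArbP K)
    {T : Set (Set (ArbP K))} (hT : T.Finite) (hball : ∀ G ∈ T, IsOpenTreeBall G) :
    ∃ x : P1 K, ∀ G ∈ T, classical x ∈ G ↔ P ∈ G := by
  let _ := weakTree K
  by_cases hP : ∃ G ∈ T, P ∈ @frontier _ (weakTree K) G
  · obtain ⟨G, hG, hPG⟩ := hP
    obtain ⟨b, s, hs, I, hI, rfl⟩ := hball G hG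
    rw [frontier_absSub_preimage b I (fineTree_le_weakTree K) le_rfl,
      IsHalfLine.frontier_eq (.inl hI) (ENNReal.ofReal_pos.2 (pos_of_mem_valueGroup hs)).ne'
        ENNReal.ofReal_ne_top, image_singleton, mem_singleton_iff] at hPG
    choose! c r _ J _ hGJ using hball
    obtain ⟨x, hx⟩ := exists_absSub_classical_eq (hT.image c) b hs
    refine ⟨x, fun G hG => ?_⟩
    rw [hGJ G hG, mem_preimage, mem_preimage, hx _ (mem_image_of_mem c hG), hPG]
  · push Not at hP
    have hev : ∀ᶠ Q in 𝓝 P, ∀ G ∈ T, Q ∈ G ↔ P ∈ G := by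
      refine (hT.eventually_all).2 fun G hG => ?_
      have hPG : P ∈ interior G ∪ interior Gᶜ := by
        rw [← compl_frontier_eq_union_interior]
        exact hP G hG
      rcases hPG with hPG | hPG
      · filter_upwards [mem_interior_iff_mem_nhds.1 hPG] with Q hQ
        exact iff_of_true hQ (interior_subset hPG)
      · filter_upwards [mem_interior_iff_mem_nhds.1 hPG] with Q hQ
        exact iff_of_false hQ (interior_subset hPG)
    obtain ⟨_, hx, x, rfl⟩ := (hev.and_frequently
      (mem_closure_iff_frequently.1 (denseRange_classical P))).exists
    exact ⟨x, hx⟩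

theorem IsAffinoidCover.exists_mem_nhds [DenseValues K] [Infinite (ResidueField K)]
    {C : Set (Set (P1 K))} (hC : IsAffinoidCover C) (P : ArbP K) :
    ∃ U ∈ @nhds _ (weakTree K) P, classical ⁻¹' U ∈ C := by
  choose! f hfin hball hYf using fun Y hY => (hC.2.1 Y hY).exists_openTreeBalls
  obtain ⟨x, hx⟩ := exists_classical_mem_iff P (hC.1.biUnion hfin)
    (by simpa only [mem_iUnion₂, forall_exists_index] using fun G Y hY => hball Y hY G)
  obtain ⟨Y, hY, hxY⟩ : x ∈ ⋃₀ C := hC.2.2 ▸ mem_univ x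
  let _ := weakTree K
  have hopen : IsOpen (⋂₀ f Y) := (hfin Y hY).isOpen_sInter fun G hG => (hball Y hY G hG).isOpen
  rw [hYf Y hY] at hxY
  exact ⟨⋂₀ f Y, hopen.mem_nhds fun G hG => (hx G (mem_biUnion hY hG)).1 (hxY G hG),
    hYf Y hY ▸ hY⟩

end Affinoid

/-! ## Cauchy filters on the projective line -/

section Completeness

variable {K : Type*} [NormedField K] [IsUltrametricDist K]

theorem exists_supr_eq_of_le_max {σ : K → ℝ≥0} (hle : ∀ a b, σ a ≤ max (σ b) (nndist b a))
    (hnndist : ∀ a b, nndist b a ≤ max (σ b) (σ a)) :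
    ∃ S : Arb K, ∀ a, supr S (pt a 0) = σ a := by
  obtain ⟨u, -, hlim, hu⟩ := exists_seq_tendsto_sInf (range_nonempty σ) (OrderBot.bddBelow _)
  choose c hc using hu
  have hdist : ∀ m n, dist (pt (c m) (u m)) (pt (c n) (u n)) = dist (u m) (u n) / 2 := by
    intro m n
    have h := hnndist (c n) (c m)
    rw [hc, hc] at h
    rw [dist_pt, max_eq_left (by exact_mod_cast h), NNReal.dist_eq]
    grind
  have hcauchy : CauchySeq fun n => pt (c n) (u n) := by
    refine Metric.cauchySeq_iff.2 fun ε hε => ?_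
    obtain ⟨N, hN⟩ := Metric.cauchySeq_iff.1 hlim.cauchySeq ε hε
    refine ⟨N, fun m hm n hn => ?_⟩
    rw [hdist]
    exact (half_le_self dist_nonneg).trans_lt (hN m hm n hn)
  obtain ⟨S, hS⟩ := cauchySeq_tendsto_of_complete hcauchy
  refine ⟨S, fun a => tendsto_nhds_unique (((continuous_supr_left _).tendsto S).comp hS) ?_⟩
  have hsup : ∀ n, supr (pt (c n) (u n)) (pt a 0) = max (u n) (σ a) := by
    intro n
    have h₁ := hle a (c n)
    have h₂ := hnndist a (c n)
    rw [hc] at h₁ h₂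
    rw [supr_pt_zero, dist_nndist]
    exact_mod_cast le_antisymm (max_le (le_max_left _ _) h₂) (max_le (le_max_left _ _) h₁)
  have hmax : Tendsto (fun n => max (u n) (σ a)) atTop (𝓝 (max (sInf (range σ)) (σ a))) :=
    hlim.max tendsto_const_nhds
  rw [max_eq_right (csInf_le (OrderBot.bddBelow _) (mem_range_self a))] at hmax
  refine (NNReal.tendsto_coe.2 hmax).congr fun n => ?_
  rw [Function.comp_apply, hsup, NNReal.coe_max]

/-- Together with `absSub_le_max` and `edist_le_max_absSub`, this identifies the projective tree
with the set of functions on `K` that satisfy the ultrametric inequalities. -/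
theorem exists_absSub_eq {ρ : K → ℝ≥0∞} (hle : ∀ a b, ρ a ≤ max (ρ b) (edist b a))
    (hedist : ∀ a b, edist b a ≤ max (ρ b) (ρ a)) : ∃ P : ArbP K, ∀ a, absSub a P = ρ a := by
  by_cases htop : ∃ b, ρ b = ⊤
  · obtain ⟨b, hb⟩ := htop
    refine ⟨.infty, fun a => ?_⟩
    have h := hle b a
    rw [hb, top_le_iff, max_eq_top] at h
    rw [absSub_infty, h.resolve_right (edist_ne_top a b)]
  · push Not at htop
    lift ρ to K → ℝ≥0 using htop
    simp only [edist_nndist] at hle hedist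
    obtain ⟨S, hS⟩ := exists_supr_eq_of_le_max (σ := ρ) (fun a b => by exact_mod_cast hle a b)
      (fun a b => by exact_mod_cast hedist a b)
    exact ⟨.of S, fun a => by rw [absSub_of, hS, ENNReal.ofReal_coe_nnreal]⟩

theorem tendsto_nhds_of_forall_lt {α X : Type*} [LinearOrder α] [DenselyOrdered α]
    [TopologicalSpace α] [OrderTopology α] {l : Filter X} {f : X → α} {c : α}
    (h : ∀ s t, s < t → (c < s → ∀ᶠ x in l, f x ≤ t) ∧ (t < c → ∀ᶠ x in l, s ≤ f x)) :
    Tendsto f l (𝓝 c) := by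
  refine tendsto_order.2 ⟨fun u hu => ?_, fun u hu => ?_⟩
  · obtain ⟨t, hut, htc⟩ := exists_between hu
    obtain ⟨s, hus, hst⟩ := exists_between hut
    exact ((h s t hst).2 htc).mono fun x hx => hus.trans_le hx
  · obtain ⟨s, hcs, hsu⟩ := exists_between hu
    obtain ⟨t, hst, htu⟩ := exists_between hsu
    exact ((h s t hst).1 hcs).mono fun x hx => hx.trans_lt htu

omit [IsUltrametricDist K] in
theorem IsOpenBall.union_prod_mem_entourages {B B' : Set (P1 K)} (hB : IsOpenBall B)
    (hB' : IsOpenBall B') (hunion : B ∪ B' = univ) : B ×ˢ B ∪ B' ×ˢ B' ∈ entourages K := by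
  have haff : ∀ {B : Set (P1 K)}, IsOpenBall B → IsOpenAffinoid B := fun {B} hB =>
    ⟨{B}, finite_singleton B, fun _ h => h ▸ hB, (sInter_singleton B).symm⟩
  refine ⟨{B, B'}, ⟨toFinite _, ?_, (sUnion_pair B B').trans hunion⟩, ?_⟩
  · rintro Y (rfl | rfl)
    exacts [haff hB, haff hB']
  · rw [coverEntourage, biUnion_pair]

variable [DenseValues K]

theorem exists_mem_entourages_absSub (a : K) {s t : ℝ≥0∞} (hst : s < t) :
    ∃ V ∈ entourages K, ∀ x y : P1 K, (x, y) ∈ V →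
      (absSub a (classical x) ≤ s → absSub a (classical y) ≤ t) ∧
      (t ≤ absSub a (classical x) → s ≤ absSub a (classical y)) := by
  obtain ⟨q, hq, hsq, hqt⟩ := exists_mem_valueGroup_ofReal_between (K := K) hst
  obtain ⟨r, hr, hqr, hrt⟩ := exists_mem_valueGroup_ofReal_between (K := K) hqt
  have hlt : IsOpenBall (classical ⁻¹' (absSub a ⁻¹' Iio (.ofReal r))) :=
    isOpenBall_iff.2 ⟨a, r, hr, _, .inl rfl, rfl⟩
  have hgt : IsOpenBall (classical ⁻¹' (absSub a ⁻¹' Ioi (.ofReal q))) :=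
    isOpenBall_iff.2 ⟨a, q, hq, _, .inr rfl, rfl⟩
  refine ⟨_, hlt.union_prod_mem_entourages hgt ?_, fun x y hxy => ?_⟩
  · rw [← preimage_union, ← preimage_union, Iio_union_Ioi_of_lt hqr, preimage_univ, preimage_univ]
  · rcases hxy with ⟨hx, hy⟩ | ⟨hx, hy⟩
    · exact ⟨fun _ => hy.le.trans hrt.le, fun h => absurd (hx.trans hrt) h.not_gt⟩
    · exact ⟨fun h => absurd (hsq.trans hx) h.not_gt, fun _ => hsq.le.trans hy.le⟩

theorem IsCauchyFilter.exists_tendsto_absSub {F : Filter (P1 K)} (hF : IsCauchyFilter F) (a : K) :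
    ∃ c, Tendsto (fun x => absSub a (classical x)) F (𝓝 c) := by
  have := hF.1
  let U := Ultrafilter.of F
  obtain ⟨c, -, hc⟩ := isCompact_univ.ultrafilter_le_nhds (U.map fun x => absSub a (classical x))
    (by simp)
  have hU : Tendsto (fun x => absSub a (classical x)) U (𝓝 c) := hc
  refine ⟨c, tendsto_nhds_of_forall_lt fun s t hst => ?_⟩
  obtain ⟨V, hV, hVa⟩ := exists_mem_entourages_absSub a hst
  obtain ⟨A, hA, hAV⟩ := hF.2 V hV
  have hAU : ∀ᶠ x in (U : Filter (P1 K)), x ∈ A := Ultrafilter.of_le F hA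
  constructor
  · intro hcs
    obtain ⟨x, hx, hxA⟩ := ((hU.eventually_le_const hcs).and hAU).exists
    filter_upwards [hA] with y hy using (hVa x y (hAV ⟨hxA, hy⟩)).1 hx
  · intro htc
    obtain ⟨x, hx, hxA⟩ := ((hU.eventually_const_le htc).and hAU).exists
    filter_upwards [hA] with y hy using (hVa x y (hAV ⟨hxA, hy⟩)).2 hx

theorem IsCauchyFilter.exists_tendsto_classical {F : Filter (P1 K)} (hF : IsCauchyFilter F) :
    ∃ P, Tendsto classical F (@nhds _ (weakTree K) P) := by
  have := hF.1
  choose ρ hρ using hF.exists_tendsto_absSub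
  obtain ⟨P, hP⟩ := exists_absSub_eq (ρ := ρ)
    (fun a b => le_of_tendsto_of_tendsto' (hρ a) ((hρ b).max tendsto_const_nhds)
      fun x => absSub_le_max a b _)
    (fun a b => le_of_tendsto_of_tendsto' tendsto_const_nhds ((hρ b).max (hρ a))
      fun x => edist_le_max_absSub a b _)
  exact ⟨P, tendsto_nhds_weakTree.2 fun a => (hP a).symm ▸ hρ a⟩

end Completeness

/-! ## The points of `Ber K` -/

section Canonical

variable {K : Type*} [NormedField K] [IsUltrametricDist K]

/-- The trace on the projective line of the filter of weak neighbourhoods of a point of the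
projective tree. These filters are the minimal Cauchy filters. -/
noncomputable def traceFilter (P : ArbP K) : Filter (P1 K) :=
  comap classical (@nhds _ (weakTree K) P)

theorem tendsto_absSub_classical_traceFilter (a : K) (P : ArbP K) :
    Tendsto (fun x => absSub a (classical x)) (traceFilter P) (𝓝 (absSub a P)) :=
  tendsto_nhds_weakTree.1 tendsto_comap a

variable [DenseValues K]

theorem neBot_traceFilter (P : ArbP K) : (traceFilter P).NeBot := by
  let _ := weakTree K
  exact comap_neBot_iff_frequently.2 (mem_closure_iff_frequently.1 (denseRange_classical P))

theorem eq_of_traceFilter_le {P Q : ArbP K} (h : traceFilter P ≤ traceFilter Q) : P = Q := by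
  let _ := weakTree K
  have := t2Space_weakTree (K := K)
  have := neBot_traceFilter P
  have hP : Tendsto classical (traceFilter P) (𝓝 P) := tendsto_comap
  exact tendsto_nhds_unique hP (tendsto_iff_comap.2 h)

variable [Infinite (ResidueField K)]

theorem isCauchyFilter_traceFilter (P : ArbP K) : IsCauchyFilter (traceFilter P) := by
  refine ⟨neBot_traceFilter P, fun V ⟨C, hC, hCV⟩ => ?_⟩
  obtain ⟨U, hU, hUC⟩ := hC.exists_mem_nhds P
  exact ⟨_, preimage_mem_comap hU,
    (subset_biUnion_of_mem (u := fun Y => Y ×ˢ Y) hUC).trans hCV⟩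

/-- The identification of the projective tree with the Berkovich projective line. -/
noncomputable def canonicalMap (P : ArbP K) : Ber K :=
  ⟨traceFilter P, isCauchyFilter_traceFilter P, fun G hG hPG => by
    obtain ⟨Q, hQ⟩ := hG.exists_tendsto_classical
    have hGQ : G ≤ traceFilter Q := tendsto_iff_comap.1 hQ
    rw [← eq_of_traceFilter_le (hPG.trans hGQ)] at hGQ
    exact le_antisymm hGQ hPG⟩

theorem bijective_canonicalMap : Function.Bijective (canonicalMap (K := K)) := by
  constructor
  · intro P Q h
    exact eq_of_traceFilter_le (congrArg Subtype.val h).le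
  · rintro ⟨F, hF, hmin⟩
    obtain ⟨P, hP⟩ := hF.exists_tendsto_classical
    exact ⟨P, Subtype.ext (hmin _ (isCauchyFilter_traceFilter P) (tendsto_iff_comap.1 hP))⟩

theorem nhds_weakTree_eq_lift' (P : ArbP K) : @nhds _ (weakTree K) P =
    (entourages K).lift' fun V => {Q | (canonicalMap P, canonicalMap Q) ∈ hatEntourage V} := by
  let _ := weakTree K
  refine le_antisymm (le_lift'.2 fun V ⟨C, hC, hCV⟩ => ?_) (tendsto_nhds_weakTree.2 fun a => ?_)
  · obtain ⟨U, hU, hUC⟩ := hC.exists_mem_nhds P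
    filter_upwards [eventually_mem_nhds_iff.2 hU] with Q hQ
    exact ⟨_, preimage_mem_comap hU, preimage_mem_comap hQ,
      (subset_biUnion_of_mem (u := fun Y => Y ×ˢ Y) hUC).trans hCV⟩
  · refine tendsto_nhds_of_forall_lt fun s t hst => ?_
    obtain ⟨V, hV, hVa⟩ := exists_mem_entourages_absSub a hst
    have hP := tendsto_absSub_classical_traceFilter a P
    have := neBot_traceFilter P
    constructor
    · intro hPs
      filter_upwards [mem_lift' hV] with Q ⟨A, hAP, hAQ, hAV⟩
      obtain ⟨x, hx, hxA⟩ := ((hP.eventually_le_const hPs).and hAP).exists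
      have := neBot_traceFilter Q
      exact le_of_tendsto (tendsto_absSub_classical_traceFilter a Q)
        (mem_of_superset hAQ fun y hy => (hVa x y (hAV ⟨hxA, hy⟩)).1 hx)
    · intro htP
      filter_upwards [mem_lift' hV] with Q ⟨A, hAP, hAQ, hAV⟩
      obtain ⟨x, hx, hxA⟩ := ((hP.eventually_const_le htP).and hAP).exists
      have := neBot_traceFilter Q
      exact ge_of_tendsto (tendsto_absSub_classical_traceFilter a Q)
        (mem_of_superset hAQ fun y hy => (hVa x y (hAV ⟨hxA, hy⟩)).2 hx)

theorem weakTopology_eq_coinduced : weakTopology K = .coinduced canonicalMap (weakTree K) := by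
  refine TopologicalSpace.ext_iff.2 fun U => ?_
  change (∀ F ∈ U, ∃ V ∈ entourages K, ∀ G, (F, G) ∈ hatEntourage V → G ∈ U) ↔ _
  rw [isOpen_coinduced, @isOpen_iff_mem_nhds _ (weakTree K), bijective_canonicalMap.2.forall]
  refine forall₂_congr fun P _ => ?_
  have hmono : Monotone fun V : Set (P1 K × P1 K) =>
      {Q | (canonicalMap P, canonicalMap Q) ∈ hatEntourage V} :=
    fun V W h Q hQ => hatEntourage_mono h hQ
  rw [nhds_weakTree_eq_lift', mem_lift'_sets hmono]
  exact exists_congr fun V => and_congr_right' bijective_canonicalMap.2.forall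

theorem isClassicalPoint_canonicalMap (x : P1 K) :
    IsClassicalPoint (canonicalMap (classical x)) x := by
  let _ := weakTree K
  suffices comap (Prod.mk x) (entourages K) = traceFilter (classical x) by
    intro A
    change A ∈ traceFilter (classical x) ↔ _
    rw [← this]
    rfl
  refine le_antisymm (tendsto_iff_comap.1 (tendsto_nhds_weakTree.2 fun a => ?_)) ?_
  · refine tendsto_nhds_of_forall_lt fun s t hst => ?_
    obtain ⟨V, hV, hVa⟩ := exists_mem_entourages_absSub a hst
    have hV' := preimage_mem_comap (m := Prod.mk x) hV
    exact ⟨fun h => mem_of_superset hV' fun y hy => (hVa x y hy).1 h.le,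
      fun h => mem_of_superset hV' fun y hy => (hVa x y hy).2 h.le⟩
  · rintro _ ⟨V, ⟨C, hC, hCV⟩, hVA⟩
    obtain ⟨U, hU, hUC⟩ := hC.exists_mem_nhds (classical x)
    refine mem_of_superset (preimage_mem_comap hU) fun y hy => hVA (hCV ?_)
    have hxU : classical x ∈ U := mem_of_mem_nhds hU
    exact mem_biUnion hUC ⟨hxU, hy⟩

end Canonical

/-! ## Transport of structure along a bijection -/

section Transport

variable {X Y : Type*} (τ : TopologicalSpace X) {f : X → Y}

/-- A bijection, as a homeomorphism onto its target with the transported topology. -/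
noncomputable def homeomorphCoinduced (hf : Function.Bijective f) :
    @Homeomorph X Y τ (.coinduced f τ) :=
  let _ := TopologicalSpace.coinduced f τ
  (Equiv.ofBijective f hf).toHomeomorph fun _ => isOpen_coinduced.symm

theorem frontier_coinduced_image (hf : Function.Bijective f) (s : Set X) :
    @frontier Y (.coinduced f τ) (f '' s) = f '' @frontier X τ s :=
  let _ := TopologicalSpace.coinduced f τ
  ((homeomorphCoinduced τ hf).image_frontier s).symm

theorem closure_coinduced_image (hf : Function.Bijective f) (s : Set X) :
    @closure Y (.coinduced f τ) (f '' s) = f '' @closure X τ s :=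
  let _ := TopologicalSpace.coinduced f τ
  ((homeomorphCoinduced τ hf).image_closure s).symm

theorem isConnected_coinduced_image {s : Set X} (hs : @IsConnected X τ s) :
    @IsConnected Y (.coinduced f τ) (f '' s) :=
  let _ := TopologicalSpace.coinduced f τ
  hs.image f continuous_coinduced_rng.continuousOn

theorem t2Space_coinduced (hf : Function.Bijective f) (h : @T2Space X τ) :
    @T2Space Y (.coinduced f τ) :=
  let _ := TopologicalSpace.coinduced f τ
  have := h
  (homeomorphCoinduced τ hf).t2Space

end Transport

/-! ## Balls of `Ber K` -/

section BerBalls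

variable {K : Type*} [NormedField K] [IsUltrametricDist K] [DenseValues K]

theorem subset_closure_image_classical {G : Set (ArbP K)}
    (hG : G ⊆ @closure _ (weakTree K) (@interior _ (weakTree K) G)) :
    G ⊆ @closure _ (weakTree K) (classical '' (classical ⁻¹' G)) := by
  let _ := weakTree K
  rw [image_preimage_eq_inter_range]
  refine hG.trans (closure_minimal ?_ isClosed_closure)
  exact ((denseRange_classical (K := K)).open_subset_closure_inter isOpen_interior).trans
    (closure_mono (inter_subset_inter_left _ interior_subset))

variable [Infinite (ResidueField K)]

theorem preimage_mem_canonicalMap_iff {G : Set (ArbP K)} {P : ArbP K} (hG : IsOpen[weakTree K] G)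
    (hGc : Gᶜ ⊆ @closure _ (weakTree K) (@interior _ (weakTree K) Gᶜ)) :
    classical ⁻¹' G ∈ (canonicalMap P).1 ↔ P ∈ G := by
  let _ := weakTree K
  refine ⟨fun h => ?_, fun h => preimage_mem_comap (hG.mem_nhds h)⟩
  obtain ⟨U, hU, hUG⟩ := h
  by_contra hP
  obtain ⟨_, hQU, x, hx, rfl⟩ := mem_closure_iff_nhds.1 (subset_closure_image_classical hGc hP) U hU
  exact hx (hUG hQU)

theorem isClassicalPoint_iff {F : Ber K} {x : P1 K} :
    IsClassicalPoint F x ↔ F = canonicalMap (classical x) := by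
  have hx := isClassicalPoint_canonicalMap x
  refine ⟨fun h => Subtype.ext (Filter.ext fun A => (h A).trans (hx A).symm), ?_⟩
  rintro rfl
  exact hx

theorem classicalImage_eq (Y : Set (P1 K)) :
    classicalImage Y = canonicalMap '' (classical '' Y) := by
  rw [image_image]
  ext F
  simp only [classicalImage, isClassicalPoint_iff, mem_ofPred_eq, mem_image, eq_comm]

variable {r : ℝ} {I : Set ℝ≥0∞}

theorem hat_classical_preimage (a : K) (hr : 0 < r) (hI : IsOpenHalfLine (.ofReal r) I) :
    hat (classical ⁻¹' (absSub a ⁻¹' I)) = canonicalMap '' (absSub a ⁻¹' I) := by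
  let _ := weakTree K
  have hIc := hI.compl.subset_closure_interior (ENNReal.ofReal_pos.2 hr).ne' ENNReal.ofReal_ne_top
  refine ext (bijective_canonicalMap.2.forall.2 fun P => ?_)
  rw [bijective_canonicalMap.1.mem_set_image]
  exact preimage_mem_canonicalMap_iff (hI.isOpen.preimage (continuous_weakTree_absSub a))
    (absSub_preimage_subset_closure_interior a hIc)

theorem bar_classical_preimage (a : K) (hr : 0 < r) (hI : IsClosedHalfLine (.ofReal r) I) :
    bar (classical ⁻¹' (absSub a ⁻¹' I)) = canonicalMap '' (absSub a ⁻¹' I) := by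
  let _ := weakTree K
  have hI' := hI.subset_closure_interior (ENNReal.ofReal_pos.2 hr).ne' ENNReal.ofReal_ne_top
  rw [bar, classicalImage_eq, weakTopology_eq_coinduced,
    closure_coinduced_image _ bijective_canonicalMap]
  refine congrArg _ (Subset.antisymm ?_ ?_)
  · exact closure_minimal (image_preimage_subset _ _)
      (hI.isClosed.preimage (continuous_weakTree_absSub a))
  · exact subset_closure_image_classical (absSub_preimage_subset_closure_interior a hI')

end BerBalls

/-! ## The point determined by a ball -/

section ToP1

variable {K : Type*}

theorem toP1_injective : Function.Injective (toP1 : Set K → Set (P1 K)) :=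
  image_injective.2 OnePoint.coe_injective

theorem coe_mem_toP1 {z : K} {D : Set K} : (z : P1 K) ∈ toP1 D ↔ z ∈ D :=
  OnePoint.coe_injective.mem_set_image

theorem infty_notMem_toP1 (D : Set K) : (OnePoint.infty : P1 K) ∉ toP1 D := by
  rintro ⟨z, -, h⟩
  exact OnePoint.coe_ne_infty z h

theorem toP1_ne_compl_toP1 (D E : Set K) : toP1 D ≠ (toP1 E)ᶜ := fun h =>
  infty_notMem_toP1 D (h ▸ infty_notMem_toP1 E)

theorem eq_of_toP1_eq_or_eq_compl {D E : Set K} {B : Set (P1 K)}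
    (hD : B = toP1 D ∨ B = (toP1 D)ᶜ) (hE : B = toP1 E ∨ B = (toP1 E)ᶜ) : D = E := by
  rcases hD with rfl | rfl <;> rcases hE with h | h
  · exact toP1_injective h
  · exact absurd h (toP1_ne_compl_toP1 _ _)
  · exact absurd h.symm (toP1_ne_compl_toP1 _ _)
  · exact toP1_injective (compl_injective h)

end ToP1

section ClosedOrIrrationalBall

variable {K : Type*} [NormedField K] {D : Set K}

theorem exists_eq_setOf_norm_sub_le (hD : IsClosedBallK D ∨ IsIrrationalBallK D) :
    ∃ a r, 0 < r ∧ D = {z | ‖z - a‖ ≤ r} := by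
  rcases hD with ⟨a, r, hr, rfl⟩ | ⟨a, r, hr, hrK, rfl⟩
  · exact ⟨a, r, pos_of_mem_valueGroup hr, rfl⟩
  · exact ⟨a, r, hr, setOf_norm_sub_lt_eq_le_of_notMem_valueGroup a hr hrK⟩

theorem isClosedBallK_or_isIrrationalBallK (a : K) {r : ℝ} (hr : 0 < r) :
    IsClosedBallK {z | ‖z - a‖ ≤ r} ∨ IsIrrationalBallK {z | ‖z - a‖ ≤ r} := by
  by_cases hrK : r ∈ valueGroup K
  · exact .inl ⟨a, r, hrK, rfl⟩
  · exact .inr ⟨a, r, hr, hrK, (setOf_norm_sub_lt_eq_le_of_notMem_valueGroup a hr hrK).symm⟩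

theorem setOf_norm_sub_le_eq_closedBall (a : K) (r : ℝ) :
    {z | ‖z - a‖ ≤ r} = Metric.closedBall a r := by
  simp only [Metric.closedBall, dist_eq_norm]

theorem setOf_norm_sub_le_eq_setOf_edist_le (a : K) {r : ℝ} (hr : 0 ≤ r) :
    {z | ‖z - a‖ ≤ r} = {z | edist z a ≤ ENNReal.ofReal r} := by
  simp only [edist_dist, dist_eq_norm, ENNReal.ofReal_le_ofReal_iff hr]

end ClosedOrIrrationalBall

section Core

variable {K : Type*} [NormedField K] [DenseValues K]

theorem exists_lt_edist_lt (a : K) {s t : ℝ≥0∞} (hst : s < t) :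
    ∃ z, s < edist z a ∧ edist z a < t := by
  obtain ⟨_, ⟨c, -, rfl⟩, hs, ht⟩ := exists_mem_valueGroup_ofReal_between (K := K) hst
  refine ⟨c + a, ?_⟩
  rw [edist_dist, dist_eq_norm, add_sub_cancel_right]
  exact ⟨hs, ht⟩

theorem eq_of_setOf_edist_le_eq {a : K} {s t : ℝ≥0∞}
    (h : {z | edist z a ≤ s} = {z | edist z a ≤ t}) : s = t := by
  wlog hst : s < t generalizing s t
  · exact (not_lt.1 hst).eq_or_lt.elim Eq.symm fun hts => (this h.symm hts).symm
  obtain ⟨z, hs, ht⟩ := exists_lt_edist_lt a hst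
  exact absurd (h.ge ht.le) hs.not_ge

variable [IsUltrametricDist K]

theorem metric_diam_eq_of_ball_subset {a : K} {r : ℝ} {E : Set K} (hr : 0 ≤ r)
    (hball : Metric.ball a r ⊆ E) (hE : E ⊆ Metric.closedBall a r) : Metric.diam E = r := by
  have hdist : ∀ x ∈ E, ∀ y ∈ E, dist x y ≤ r := fun x hx y hy =>
    (dist_triangle_max x a y).trans (max_le (hE hx) (dist_comm y a ▸ hE hy))
  refine le_antisymm (Metric.diam_le_of_forall_dist_le hr hdist) (le_of_forall_lt fun c hcr => ?_)
  rcases lt_or_ge c 0 with hc | hc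
  · exact hc.trans_le Metric.diam_nonneg
  obtain ⟨_, ⟨y, -, rfl⟩, hcy, hyr⟩ := DenseValues.exists_mem_valueGroup_between (K := K) hc hcr
  have hya : dist (y + a) a = ‖y‖ := by rw [dist_eq_norm, add_sub_cancel_right]
  calc c < dist (y + a) a := hya ▸ hcy
    _ ≤ Metric.diam E := Metric.dist_le_diam_of_mem (Metric.isBounded_iff.2 ⟨r, fun x hx y hy =>
        hdist x hx y hy⟩) (hball (hya.trans_lt hyr)) (hball (Metric.mem_ball_self
          ((norm_nonneg y).trans_lt hyr)))

variable [Infinite (ResidueField K)] {P : ArbP K}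

theorem toP1_norm_sub_lt_mem_canonicalMap_iff (a : K) {r : ℝ} (hr : 0 < r) :
    toP1 {z | ‖z - a‖ < r} ∈ (canonicalMap P).1 ↔ absSub a P < ENNReal.ofReal r := by
  change canonicalMap P ∈ hat _ ↔ _
  rw [toP1_norm_sub_lt a hr, hat_classical_preimage a hr (.inl rfl),
    bijective_canonicalMap.1.mem_set_image, mem_preimage, mem_Iio]

theorem absSub_le_of_toP1_norm_sub_le_mem {a : K} {r : ℝ} (hr : 0 < r)
    (h : toP1 {z | ‖z - a‖ ≤ r} ∈ (canonicalMap P).1) : absSub a P ≤ ENNReal.ofReal r := by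
  rw [toP1_norm_sub_le a hr] at h
  have := neBot_traceFilter P
  exact le_of_tendsto (tendsto_absSub_classical_traceFilter a P) h

theorem coe_mem_core_canonicalMap_iff {x : K} :
    (x : P1 K) ∈ core (canonicalMap P) ↔ ∀ a, edist x a ≤ absSub a P := by
  constructor
  · refine fun hx a => le_of_forall_gt fun t ht => ?_
    obtain ⟨c, hc, hPc, hct⟩ := exists_mem_valueGroup_ofReal_between (K := K) ht
    have hc0 := pos_of_mem_valueGroup hc
    have hxc : x ∈ {z | ‖z - a‖ < c} := coe_mem_toP1.1 <|
      hx _ ⟨(toP1_norm_sub_lt_mem_canonicalMap_iff a hc0).2 hPc, _, .inl ⟨a, c, hc, rfl⟩, rfl⟩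
    rw [edist_dist, dist_eq_norm]
    exact ((ENNReal.ofReal_lt_ofReal_iff hc0).2 hxc).trans hct
  · have hlt : ∀ a c, (∀ a, edist x a ≤ absSub a P) → 0 < c →
        toP1 {z | ‖z - a‖ < c} ∈ (canonicalMap P).1 → ‖x - a‖ < c := by
      intro a c hx hc h
      rw [← ENNReal.ofReal_lt_ofReal_iff hc, ← dist_eq_norm, ← edist_dist]
      exact (hx a).trans_lt ((toP1_norm_sub_lt_mem_canonicalMap_iff a hc).1 h)
    rintro hx _ ⟨hA, D, ⟨a, c, hc, rfl⟩ | ⟨a, c, hc, rfl⟩ | ⟨a, c, hc, -, rfl⟩, rfl⟩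
    · exact coe_mem_toP1.2 (hlt a c hx (pos_of_mem_valueGroup hc) hA)
    · have hc := pos_of_mem_valueGroup hc
      refine coe_mem_toP1.2 ((ENNReal.ofReal_le_ofReal_iff hc.le).1 ?_)
      rw [← dist_eq_norm, ← edist_dist]
      exact (hx a).trans (absSub_le_of_toP1_norm_sub_le_mem hc hA)
    · exact coe_mem_toP1.2 (hlt a c hx hc hA)

theorem coe_mem_core_canonicalMap_ray_iff {a x : K} {t : ℝ≥0∞} :
    (x : P1 K) ∈ core (canonicalMap (ray a t)) ↔ edist x a ≤ t := by
  rw [coe_mem_core_canonicalMap_iff]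
  refine ⟨fun h => absSub_ray_self a t ▸ h a, fun h b => ?_⟩
  rw [← ray_eq_ray h, absSub_ray]
  exact le_max_right _ _

theorem infty_notMem_core_canonicalMap_ray (a : K) {t : ℝ≥0∞} (ht : t ≠ ⊤) :
    OnePoint.infty ∉ core (canonicalMap (ray a t)) := by
  obtain ⟨c, hc, htc, -⟩ := exists_mem_valueGroup_ofReal_between (K := K) ht.lt_top
  refine fun h => infty_notMem_toP1 {z | ‖z - a‖ < c} (h _ ⟨?_, _, .inl ⟨a, c, hc, rfl⟩, rfl⟩)
  rwa [toP1_norm_sub_lt_mem_canonicalMap_iff a (pos_of_mem_valueGroup hc), absSub_ray_self]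

theorem core_canonicalMap_ray (a : K) {t : ℝ≥0∞} (ht : t ≠ ⊤) :
    core (canonicalMap (ray a t)) = toP1 {z | edist z a ≤ t} := by
  ext w
  induction w using OnePoint.rec with
  | infty => exact iff_of_false (infty_notMem_core_canonicalMap_ray a ht) (infty_notMem_toP1 _)
  | coe z => rw [coe_mem_core_canonicalMap_ray_iff, coe_mem_toP1, mem_ofPred_eq]

theorem eq_ray_of_mem_core {x : K} (hx : (x : P1 K) ∈ core (canonicalMap P)) :
    P = ray x (absSub x P) := by
  rw [coe_mem_core_canonicalMap_iff] at hx
  refine (eq_ray_or_exists_absSub_lt x P).resolve_right ?_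
  rintro ⟨b, hb⟩
  refine hb.not_ge ((absSub_le_max x b P).trans (max_le le_rfl ?_))
  exact edist_comm b x ▸ hx b

theorem core_canonicalMap_eq_iff {a : K} {t : ℝ≥0∞} (ht : t ≠ ⊤) :
    core (canonicalMap P) = toP1 {z | edist z a ≤ t} ↔ P = ray a t := by
  refine ⟨fun h => ?_, fun h => h ▸ core_canonicalMap_ray a ht⟩
  have hP : P = ray a (absSub a P) := eq_ray_of_mem_core <| by
    rw [h, coe_mem_toP1, mem_ofPred_eq, edist_self]
    exact zero_le
  rw [hP] at h ⊢
  congr 1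
  refine eq_of_setOf_edist_le_eq (a := a) (ext fun z => ?_)
  rw [mem_ofPred_eq, ← coe_mem_core_canonicalMap_ray_iff, h, coe_mem_toP1]

theorem isPointOfBall_canonicalMap_iff {a : K} {r : ℝ} (hr : 0 < r) {E : Set K} {B : Set (P1 K)}
    (hball : Metric.ball a r ⊆ E) (hE : E ⊆ Metric.closedBall a r)
    (hB : B = toP1 E ∨ B = (toP1 E)ᶜ) :
    IsPointOfBall (canonicalMap P) B ↔ P = ray a (ENNReal.ofReal r) := by
  constructor
  · rintro ⟨D, E', hB', hD, hED, hdiam, hcore⟩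
    obtain rfl := eq_of_toP1_eq_or_eq_compl hB hB'
    obtain ⟨b, s, hs, rfl⟩ := exists_eq_setOf_norm_sub_le hD
    obtain rfl : s = r := by
      rwa [metric_diam_eq_of_ball_subset hr.le hball hE, setOf_norm_sub_le_eq_closedBall,
        metric_diam_eq_of_ball_subset hs.le Metric.ball_subset_closedBall subset_rfl] at hdiam
    rw [setOf_norm_sub_le_eq_setOf_edist_le b hs.le] at hcore hED
    rw [(core_canonicalMap_eq_iff ENNReal.ofReal_ne_top).1 hcore]
    exact (ray_eq_ray (hED (hball (Metric.mem_ball_self hs)))).symm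
  · rintro rfl
    refine ⟨{z | ‖z - a‖ ≤ r}, E, hB, isClosedBallK_or_isIrrationalBallK a hr, ?_, ?_, ?_⟩
    · rwa [setOf_norm_sub_le_eq_closedBall]
    · rw [setOf_norm_sub_le_eq_closedBall, metric_diam_eq_of_ball_subset hr.le hball hE,
        metric_diam_eq_of_ball_subset hr.le Metric.ball_subset_closedBall subset_rfl]
    · rw [setOf_norm_sub_le_eq_setOf_edist_le a hr.le,
        core_canonicalMap_ray a ENNReal.ofReal_ne_top]

end Core

/-! ## The canonical map and the balls of `Ber K` -/

section CanonicalMap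

variable {K : Type*} [NormedField K] [IsUltrametricDist K] [DenseValues K]
  [Infinite (ResidueField K)]

theorem isCanonicalMap_canonicalMap : IsCanonicalMap (canonicalMap (K := K)) where
  continuous := by
    rw [weakTopology_eq_coinduced, continuous_iff_coinduced_le]
    exact coinduced_mono (fineTree_le_weakTree K)
  core_eq x r _ := by
    rw [← ray_coe, core_canonicalMap_ray x ENNReal.coe_ne_top,
      setOf_norm_sub_le_eq_setOf_edist_le x r.coe_nonneg, ENNReal.ofReal_coe_nnreal]

theorem IsCanonicalMap.eq_canonicalMap {ι : ArbP K → Ber K} (hι : IsCanonicalMap ι) :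
    ι = canonicalMap := by
  have hT2 : @T2Space _ (weakTopology K) := by
    rw [weakTopology_eq_coinduced]
    exact t2Space_coinduced _ bijective_canonicalMap t2Space_weakTree
  let _ := weakTopology K
  refine denseRange_pt_pos.equalizer hι.continuous isCanonicalMap_canonicalMap.continuous ?_
  ext1 ⟨x, r, hr⟩
  obtain ⟨P, hP⟩ := bijective_canonicalMap.2 (ι (.of (pt x r)))
  have hcore := hι.core_eq x r hr
  rw [← hP, setOf_norm_sub_le_eq_setOf_edist_le x r.coe_nonneg, ENNReal.ofReal_coe_nnreal,
    core_canonicalMap_eq_iff ENNReal.coe_ne_top, ray_coe] at hcore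
  rw [Function.comp_apply, Function.comp_apply, ← hP, hcore]

variable {a : K} {r : ℝ} {I : Set ℝ≥0∞}

omit [DenseValues K] [Infinite (ResidueField K)] in
theorem exists_preimage_eq_toP1_or_compl (a : K) (hr : 0 < r)
    (hI : IsHalfLine (.ofReal r) I) :
    ∃ E, Metric.ball a r ⊆ E ∧ E ⊆ Metric.closedBall a r ∧
      (classical ⁻¹' (absSub a ⁻¹' I) = toP1 E ∨ classical ⁻¹' (absSub a ⁻¹' I) = (toP1 E)ᶜ) := by
  have hball : Metric.ball a r = {z | ‖z - a‖ < r} := by simp only [Metric.ball, dist_eq_norm]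
  have hle := Metric.ball_subset_closedBall (x := a) (ε := r)
  rw [← setOf_norm_sub_le_eq_closedBall, hball] at *
  rcases hI with (rfl | rfl) | rfl | rfl
  · exact ⟨_, subset_rfl, hle, .inl (toP1_norm_sub_lt a hr).symm⟩
  · exact ⟨_, hle, subset_rfl, .inr (compl_toP1_norm_sub_le a hr).symm⟩
  · exact ⟨_, hle, subset_rfl, .inl (toP1_norm_sub_le a hr).symm⟩
  · exact ⟨_, subset_rfl, hle, .inr (compl_toP1_norm_sub_lt a hr).symm⟩

theorem isPointOfBall_classical_preimage_iff (hr : 0 < r)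
    (hI : IsHalfLine (.ofReal r) I) {G : Ber K} :
    IsPointOfBall G (classical ⁻¹' (absSub a ⁻¹' I)) ↔ G = canonicalMap (ray a (.ofReal r)) := by
  obtain ⟨E, hball, hE, hIE⟩ := exists_preimage_eq_toP1_or_compl a hr hI
  obtain ⟨P, rfl⟩ := bijective_canonicalMap.2 G
  rw [isPointOfBall_canonicalMap_iff hr hball hE hIE, bijective_canonicalMap.1.eq_iff]

theorem IsBerBall.exists_halfLine {B : Set (P1 K)} {𝔅 : Set (Ber K)} (h : IsBerBall B 𝔅) :
    ∃ a r, 0 < r ∧ ∃ I, IsHalfLine (.ofReal r) I ∧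
      B = classical ⁻¹' (absSub a ⁻¹' I) ∧ 𝔅 = canonicalMap '' (absSub a ⁻¹' I) := by
  rcases h with ⟨hB, rfl⟩ | ⟨hB, rfl⟩
  · have hB' : ∃ a r, 0 < r ∧ ∃ I, IsOpenHalfLine (.ofReal r) I ∧
        B = classical ⁻¹' (absSub a ⁻¹' I) := by
      refine hB.elim (fun hB => ?_) IsIrrationalBall.exists_openHalfLine
      obtain ⟨a, r, hr, I, hI, hBI⟩ := isOpenBall_iff.1 hB
      exact ⟨a, r, pos_of_mem_valueGroup hr, I, hI, hBI⟩
    obtain ⟨a, r, hr, I, hI, rfl⟩ := hB'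
    exact ⟨a, r, hr, I, .inl hI, rfl, hat_classical_preimage a hr hI⟩
  · obtain ⟨a, r, hr, I, hI, rfl⟩ :=
      hB.elim IsClosedBall.exists_halfLine IsIrrationalBall.exists_closedHalfLine
    exact ⟨a, r, hr, I, .inr hI, rfl, bar_classical_preimage a hr hI⟩

theorem frontier_canonicalMap_image (hr : 0 < r) (hI : IsHalfLine (.ofReal r) I)
    {τ : TopologicalSpace (ArbP K)} (hfine : fineTree K ≤ τ) (hweak : τ ≤ weakTree K) :
    @frontier _ (.coinduced canonicalMap τ) (canonicalMap '' (absSub a ⁻¹' I)) =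
      {canonicalMap (ray a (.ofReal r))} := by
  rw [frontier_coinduced_image τ bijective_canonicalMap, frontier_absSub_preimage a I hfine hweak,
    hI.frontier_eq (ENNReal.ofReal_pos.2 hr).ne' ENNReal.ofReal_ne_top, image_singleton,
    image_singleton]

end CanonicalMap

end BerkovichLine

theorem mainTheorem11_general (K : Type*) [NormedField K] [IsUltrametricDist K]
    (hres : Infinite (IsLocalRing.ResidueField (NormedField.valuation (K := K)).valuationSubring))
    (hval : ¬ DiscreteTopology (valueGroup K)) :
    ∃ ι : ArbP K → Ber K,
      IsCanonicalMap ι ∧ (∀ ι' : ArbP K → Ber K, IsCanonicalMap ι' → ι' = ι) ∧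
      Function.Bijective ι ∧
      ∀ (B : Set (P1 K)) (𝔅 : Set (Ber K)), IsBerBall B 𝔅 →
        @IsConnected _ (weakTopology K) 𝔅 ∧
        @IsConnected _ (fineTopology ι) 𝔅 ∧
        ∃ F : Ber K, (∀ G : Ber K, IsPointOfBall G B ↔ G = F) ∧
          @frontier _ (weakTopology K) 𝔅 = {F} ∧
          @frontier _ (fineTopology ι) 𝔅 = {F} := by
  have := DenseValues.of_not_discreteTopology hval
  refine ⟨canonicalMap, isCanonicalMap_canonicalMap, fun _ h => h.eq_canonicalMap,
    bijective_canonicalMap, fun B 𝔅 hB => ?_⟩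
  obtain ⟨a, r, hr, I, hI, rfl, rfl⟩ := hB.exists_halfLine
  have hIne : I.Nonempty := hI.nonempty (ENNReal.ofReal_pos.2 hr).ne' ENNReal.ofReal_ne_top
  have hconn : IsConnected (absSub a ⁻¹' I) := isConnected_absSub_preimage a hI.ordConnected hIne
  refine ⟨?_, isConnected_coinduced_image _ hconn, canonicalMap (ray a (.ofReal r)),
    fun G => isPointOfBall_classical_preimage_iff hr hI, ?_, ?_⟩
  · let _ := weakTopology K
    exact hconn.image _ isCanonicalMap_canonicalMap.continuous.continuousOn
  · rw [weakTopology_eq_coinduced]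
    exact frontier_canonicalMap_image hr hI (fineTree_le_weakTree K) le_rfl
  · exact frontier_canonicalMap_image hr hI le_rfl (fineTree_le_weakTree K)

theorem mainTheorem11 (K : Type*) [NormedField K] [IsUltrametricDist K] [CompleteSpace K]
    (hres : Infinite (IsLocalRing.ResidueField (NormedField.valuation (K := K)).valuationSubring))
    (hval : ¬ DiscreteTopology (valueGroup K)) :
    ∃ ι : ArbP K → Ber K,
      IsCanonicalMap ι ∧ (∀ ι' : ArbP K → Ber K, IsCanonicalMap ι' → ι' = ι) ∧
      Function.Bijective ι ∧
      ∀ (B : Set (P1 K)) (𝔅 : Set (Ber K)), IsBerBall B 𝔅 →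
        @IsConnected _ (weakTopology K) 𝔅 ∧
        @IsConnected _ (fineTopology ι) 𝔅 ∧
        ∃ F : Ber K, (∀ G : Ber K, IsPointOfBall G B ↔ G = F) ∧
          @frontier _ (weakTopology K) 𝔅 = {F} ∧
          @frontier _ (fineTopology ι) 𝔅 = {F} :=
  mainTheorem11_general K hres hval
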